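/- **Conventions.** Let $\mathbf K$ be $\mathbb R$ or $\mathbb C$. Locally convex spaces are Hausdorff, over $\mathbf K$. A *partial map* $f:E\supseteq\operatorname{dom} f\to F$ is a function defined on a subset of $E$; equality and composition of partial maps include equality of (maximal) domains. **Class $C^k_\Pi$** ($k\in\mathbb N_0\cup\{\infty\}$; $\mathbb N_0=\{0,1,2,\dots\}$). $f:E\supseteq\Omega\to F$ is of class $C^k_\Pi$ if $\Omega$ is open and for every finite $l\le k$ and $x\in\Omega$ the iterated directional derivatives $d^lf(x)(u_1,\dots,u_l)$ exist for all $u_1,\dots,u_l\in E$ (where $d^0f=f$ and $d^{l+1}f(x)(u_1,\dots,u_l,h)=\lim_{t\to0}t^{-1}\big(d^lf(x+th)-d^lf(x)\big)(u_1,\dots,u_l)$), the map $d^lf(x):E^l\to F$ is continuous and multilinear, and for every zero neighbourhood $W$ of $F$ there is a zero neighbourhood $U$ of $E$ such that for every $\varepsilon>0$ there is a zero neighbourhood $V$ of $E$ with $x+V\subseteq\Omega$ and $(d^lf(x+v)-d^lf(x))[U^l]\subseteq\varepsilon W$ for all $v\in V$. For a partial map $f$ from $E\times F$ to $G$, write $\partial_2f(x,y)v=\lim_{t\to0}t^{-1}(f(x,y+tv)-f(x,y))$.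 **$B\partial_2$-extensibility.** Let $k\in\{1,2,\dots\}\cup\{\infty\}$. A partial map $f$ from $E\times F$ to $F$ is *$B\partial_2$-extensible in $C^k_\Pi$ around $(x^0,y^0,b)$* if $(x^0,y^0)\in\operatorname{dom}f$, $f(x^0,y^0)=b$, and there are a nonempty directed preordered set $I$, a projective system of Banach spaces $F_i$ ($i\in I$) with continuous linear maps $\rho_{ij}:F_j\to F_i$ ($i\le j$), continuous linear maps $\rho_i:F\to F_i$ making $F$ the projective limit of this system in the category of locally convex spaces, and partial maps $f_i$ from $E\times F_i$ to $F_i$ of class $C^k_\Pi$ such that, for every $i$ and every $(x,y)\in\operatorname{dom}f$, $(x,\rho_iy)\in\operatorname{dom}f_i$ and $f_i(x,\rho_iy)=\rho_if(x,y)$; and there are $i_0\in I$ and an open $W_0\subseteq E\times F_{i_0}$ with $(x^0,\rho_{i_0}y^0)\in W_0\subseteq\operatorname{dom}f_{i_0}$ such that 1. $\partial_2f_{i_0}(x^0,\rho_{i_0}y^0):F_{i_0}\to F_{i_0}$ is bijective; and for every $j\ge i_0$: 2. $\rho_{i_0j}$ is injective, $\rho_j\circ f=f_j\circ(\mathrm{id}\times\rho_j)$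 and $\rho_{i_0j}\circ f_j=f_{i_0}\circ(\mathrm{id}\times\rho_{i_0j})$ as partial maps; 3. if $(x,y)\in\operatorname{dom}f_j$, $(x,\rho_{i_0j}y)\in W_0$ and $\partial_2f_{i_0}(x,\rho_{i_0j}y)$ is bijective $F_{i_0}\to F_{i_0}$, then $\partial_2f_j(x,y)$ is bijective $F_j\to F_j$; 4. if $(x^1,y^1)\in\operatorname{dom}f_{i_0}$, $f_{i_0}(x^1,y^1)=\rho_{i_0}b$ and $(y_n)_{n\ge1}$ is a sequence in $F_j$ such that for all $n\ge1$ the point $\big(\tfrac1nx^0+(1-\tfrac1n)x^1,\rho_{i_0j}y_n\big)$ lies in $\operatorname{dom}f_{i_0}$ and is mapped by $f_{i_0}$ to $\rho_{i_0}b$, and $\rho_{i_0j}y_n\to y^1$ in $F_{i_0}$, then $y^1\in\rho_{i_0j}[F_j]$. A partial map $f$ from $E$ to $E$ is *BI-extensible in $C^k_\Pi$ about* $z=(x_0,y_0)\in E\times E$ if the partial map $(x,v)\mapsto f(v)-x$, with domain $E\times\operatorname{dom}f$, is $B\partial_2$-extensible in $C^k_\Pi$ around $(x_0,y_0,0)$.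 **Corollary 4.6.** Let $E$ be a locally convex space, let $k\in\{1,2,\dots\}\cup\{\infty\}$, and let $f$ be a partial map from $E$ to $E$ which is BI-extensible in $C^k_\Pi$ about $z\in E\times E$. Then there are open sets $U,V\subseteq E$ with $z\in V\times U$ and $U\subseteq\operatorname{dom}f$ such that $f|U$ is a bijection $U\to V$ and both $f|U$ and its inverse $V\to U$ are of class $C^k_\Pi$. -/

import Mathlib

open Filter Topology

/-! Real or complex Hausdorff locally convex spaces are encoded by the Mathlib classes
`AddCommGroup`, `Module 𝕜`, `TopologicalSpace`, `IsTopologicalAddGroup`, `ContinuousSMul 𝕜`,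
`PolynormableSpace 𝕜` (the topology is given by seminorms, i.e. local convexity) and `T2Space`.

A partially defined map from `E` to `F` is a pair `(Ω, f)` of a domain `Ω : Set E` and a function
`f : E → F` of which only the values on `Ω` matter. -/

universe uE uF uG uI uB

section Keller

variable (𝕜 : Type) [RCLike 𝕜]
  {E : Type uE} [AddCommGroup E] [Module 𝕜 E] [TopologicalSpace E]
  {F : Type uF} [AddCommGroup F] [Module 𝕜 F] [TopologicalSpace F]

/-- `D l x` (for `x ∈ Ω` and `l ≤ k`) is the `l`-th differential of `(Ω, f)` at `x`: it is the
function assigning to `(u₁, …, uₗ)` the iterated directional derivative of `f` in the directions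
`u₁, …, uₗ`, it is continuous and multilinear, and `x ↦ D l x` satisfies Keller's
continuity condition `Π`. -/
structure HasKellerSeries (k : ℕ∞) (Ω : Set E) (f : E → F)
    (D : ∀ l : ℕ, E → ContinuousMultilinearMap 𝕜 (fun _ : Fin l => E) F) : Prop where
  zero_eq : ∀ x ∈ Ω, ∀ u : Fin 0 → E, D 0 x u = f x
  dirDeriv : ∀ l : ℕ, (l : ℕ∞) < k → ∀ x ∈ Ω, ∀ (u : Fin l → E) (h : E),
    Tendsto (fun t : 𝕜 => t⁻¹ • (D l (x + t • h) u - D l x u)) (𝓝[≠] 0)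
      (𝓝 (D (l + 1) x (Fin.snoc u h)))
  cont : ∀ l : ℕ, (l : ℕ∞) ≤ k → ∀ x ∈ Ω, ∀ W ∈ 𝓝 (0 : F), ∃ U ∈ 𝓝 (0 : E),
    ∀ ε : ℝ, 0 < ε → ∃ V ∈ 𝓝 (0 : E), ∀ v ∈ V, x + v ∈ Ω ∧
      ∀ u : Fin l → E, (∀ i, u i ∈ U) → ∃ w ∈ W, D l (x + v) u - D l x u = (ε : 𝕜) • w

/-- The Keller class `C^k_Π`: the domain is open and all differentials up to order `k` exist
with the required continuity. -/
def IsKeller (k : ℕ∞) (Ω : Set E) (f : E → F) : Prop :=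
  IsOpen Ω ∧ ∃ D : ∀ l : ℕ, E → ContinuousMultilinearMap 𝕜 (fun _ : Fin l => E) F,
    HasKellerSeries 𝕜 k Ω f D

/-- `(Ω, f)` is a local `C^k_Π` diffeomorphism `U → V`: `f` is defined on `U`, the restriction of
`f` to `U` is a bijection onto `V`, and this restriction and its inverse are of class `C^k_Π`
(in particular `U` and `V` are open). -/
def IsLocalKellerDiffeo (k : ℕ∞) (Ω : Set E) (f : E → F) (U : Set E) (V : Set F) : Prop :=
  U ⊆ Ω ∧ Set.BijOn f U V ∧ IsKeller 𝕜 k U f ∧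
    ∃ g : F → E, Set.InvOn g f U V ∧ IsKeller 𝕜 k V g

/-- `ℓ` is the partial differential of `f` with respect to the second variable at `(x, y)`. -/
def HasPartialTwo {G : Type uG} [AddCommGroup G] [Module 𝕜 G] [TopologicalSpace G]
    (f : E × F → G) (x : E) (y : F) (ℓ : F →L[𝕜] G) : Prop :=
  ∀ v : F, Tendsto (fun t : 𝕜 => t⁻¹ • (f (x, y + t • v) - f (x, y))) (𝓝[≠] 0) (𝓝 (ℓ v))

/-- The partial differential of `f` with respect to the second variable exists at `(x, y)` and is
bijective. -/
def PartialTwoBijective (f : E × F → F) (x : E) (y : F) : Prop :=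
  ∃ ℓ : F →L[𝕜] F, HasPartialTwo 𝕜 f x y ℓ ∧ Function.Bijective ℓ

end Keller

section Limit

variable (𝕜 : Type) [RCLike 𝕜]
  {I : Type uI} [Preorder I] {B : I → Type uB} [∀ i, AddCommGroup (B i)] [∀ i, Module 𝕜 (B i)]
  [∀ i, TopologicalSpace (B i)]

/-- The transition maps `ρ i j : B j → B i` (`i ≤ j`) form a projective system. -/
def IsProjSystem (ρ : ∀ i j : I, i ≤ j → (B j →L[𝕜] B i)) : Prop :=
  (∀ i (y : B i), ρ i i le_rfl y = y) ∧
  ∀ i j k (hij : i ≤ j) (hjk : j ≤ k) (y : B k),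
    ρ i j hij (ρ j k hjk y) = ρ i k (hij.trans hjk) y

/-- The maps `q i : G → B i` form a cone over the projective system. -/
def IsCone (ρ : ∀ i j : I, i ≤ j → (B j →L[𝕜] B i))
    {G : Type uG} [AddCommGroup G] [Module 𝕜 G] [TopologicalSpace G]
    (q : ∀ i, G →L[𝕜] B i) : Prop :=
  ∀ i j (hij : i ≤ j) (x : G), q i x = ρ i j hij (q j x)

/-- `(F, p)` is a projective limit of the system in the category of Hausdorff locally convex
spaces: it is a cone, and every cone factors uniquely through it. -/
def IsLCSProjLimit (ρ : ∀ i j : I, i ≤ j → (B j →L[𝕜] B i))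
    {F : Type uF} [AddCommGroup F] [Module 𝕜 F] [TopologicalSpace F]
    (p : ∀ i, F →L[𝕜] B i) : Prop :=
  IsCone 𝕜 ρ p ∧
  ∀ (G : Type uF) [AddCommGroup G] [Module 𝕜 G] [TopologicalSpace G] [IsTopologicalAddGroup G]
    [ContinuousSMul 𝕜 G] [PolynormableSpace 𝕜 G] [T2Space G] (q : ∀ i, G →L[𝕜] B i),
    IsCone 𝕜 ρ q → ∃! ℓ : G →L[𝕜] F, ∀ i x, p i (ℓ x) = q i x

end Limit

section Extension

variable (𝕜 : Type) [RCLike 𝕜]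
  {E : Type uE} [AddCommGroup E] [Module 𝕜 E] [TopologicalSpace E]
  {F : Type uF} [AddCommGroup F] [Module 𝕜 F] [TopologicalSpace F]

/-- A `Bp₂`-extension of a partial map `(Ω, f)` from `E × F` to `F`: a presentation of `F` as a
projective limit of Banach spaces `B i`, indexed by a nonempty directed preordered set, with limit
projections `p i : F → B i`, together with partial maps `(dom i, map i)` from `E × B i` to `B i`
through which `f` lifts. -/
structure BpTwoExtension (Ω : Set (E × F)) (f : E × F → F) where
  I : Type uI
  [preorder : Preorder I]
  [nonempty : Nonempty I]
  [directed : IsDirectedOrder I]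
  B : I → Type uB
  [normed : ∀ i, NormedAddCommGroup (B i)]
  [normedSpace : ∀ i, NormedSpace 𝕜 (B i)]
  [complete : ∀ i, CompleteSpace (B i)]
  ρ : ∀ i j : I, i ≤ j → (B j →L[𝕜] B i)
  isProjSystem : IsProjSystem 𝕜 ρ
  p : ∀ i, F →L[𝕜] B i
  isLimit : IsLCSProjLimit 𝕜 ρ p
  dom : ∀ i, Set (E × B i)
  map : ∀ i, E × B i → B i
  lift : ∀ i x y, (x, y) ∈ Ω → (x, p i y) ∈ dom i ∧ map i (x, p i y) = p i (f (x, y))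

attribute [instance] BpTwoExtension.preorder BpTwoExtension.nonempty BpTwoExtension.directed
  BpTwoExtension.normed BpTwoExtension.normedSpace BpTwoExtension.complete

/-- The `Bp₂`-extension `X` of `(Ω, f)` is a `B∂₂`-extension in `C^k_Π` around `(x₀, y₀, b)`. -/
def BpTwoExtension.IsBPartialTwo {Ω : Set (E × F)} {f : E × F → F}
    (X : BpTwoExtension.{uE, uF, uI, uB} 𝕜 Ω f) (k : ℕ∞) (x₀ : E) (y₀ b : F) : Prop :=
  1 ≤ k ∧ (x₀, y₀) ∈ Ω ∧ f (x₀, y₀) = b ∧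
  (∀ i, IsKeller 𝕜 k (X.dom i) (X.map i)) ∧
  ∃ (i₀ : X.I) (W₀ : Set (E × X.B i₀)),
    IsOpen W₀ ∧ (x₀, X.p i₀ y₀) ∈ W₀ ∧ W₀ ⊆ X.dom i₀ ∧
    PartialTwoBijective 𝕜 (X.map i₀) x₀ (X.p i₀ y₀) ∧
    ∀ (j : X.I) (hj : i₀ ≤ j),
      Function.Injective (X.ρ i₀ j hj) ∧
      -- equality of the partial maps `p j ∘ f` and `map j ∘ (id × p j)`
      (∀ x y, ((x, y) ∈ Ω ↔ (x, X.p j y) ∈ X.dom j) ∧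
        ((x, y) ∈ Ω → X.p j (f (x, y)) = X.map j (x, X.p j y))) ∧
      -- equality of the partial maps `ρ i₀ j ∘ map j` and `map i₀ ∘ (id × ρ i₀ j)`
      (∀ x y, ((x, y) ∈ X.dom j ↔ (x, X.ρ i₀ j hj y) ∈ X.dom i₀) ∧
        ((x, y) ∈ X.dom j → X.ρ i₀ j hj (X.map j (x, y)) = X.map i₀ (x, X.ρ i₀ j hj y))) ∧
      -- bijectivity of the second partial differential is inherited from level `i₀`
      (∀ (x : E) (y : X.B j) (ℓ : X.B j →L[𝕜] X.B j), (x, y) ∈ X.dom j →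
        HasPartialTwo 𝕜 (X.map j) x y ℓ → (x, X.ρ i₀ j hj y) ∈ W₀ →
        PartialTwoBijective 𝕜 (X.map i₀) x (X.ρ i₀ j hj y) → Function.Bijective ℓ) ∧
      -- limits of solutions at level `j`, taken at level `i₀`, come from level `j`
      (∀ (x₁ : E) (y₁ : X.B i₀) (y : ℕ → X.B j),
        (∀ n : ℕ, 1 ≤ n →
          ((n : 𝕜)⁻¹ • x₀ + (1 - (n : 𝕜)⁻¹) • x₁, X.ρ i₀ j hj (y n)) ∈ X.dom i₀ ∧
          X.map i₀ ((n : 𝕜)⁻¹ • x₀ + (1 - (n : 𝕜)⁻¹) • x₁, X.ρ i₀ j hj (y n)) = X.p i₀ b) →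
        (x₁, y₁) ∈ X.dom i₀ → X.map i₀ (x₁, y₁) = X.p i₀ b →
        Tendsto (fun n => X.ρ i₀ j hj (y n)) atTop (𝓝 y₁) →
        y₁ ∈ Set.range (X.ρ i₀ j hj))

/-- `(Ω, f)` is `B∂₂`-extensible in `C^k_Π` around `(x₀, y₀, b)`. -/
def BPartialTwoExtensible (k : ℕ∞) (Ω : Set (E × F)) (f : E × F → F) (x₀ : E) (y₀ b : F) : Prop :=
  ∃ X : BpTwoExtension.{uE, uF, uI, uB} 𝕜 Ω f, X.IsBPartialTwo 𝕜 k x₀ y₀ b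

/-- `(Ω, f)`, a partial map from `E` to `E`, is BI-extensible in `C^k_Π` about `z`: the partial map
`(x, v) ↦ f v - x`, defined for `v ∈ Ω`, is `B∂₂`-extensible around `(z, 0)`. -/
def BIExtensible (k : ℕ∞) (Ω : Set E) (f : E → E) (z : E × E) : Prop :=
  BPartialTwoExtensible.{uE, uE, uI, uB} 𝕜 k {q : E × E | q.2 ∈ Ω} (fun q => f q.2 - q.1)
    z.1 z.2 0

end Extension

/-! Solving `f v = x` for `v` near the given point is an implicit function problem for the map `(x,
v) ↦ f v - x`. Its parameter `x` lives in a locally convex space, but at each level `j` of the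
projective system the unknown lives in a Banach space. At level `i₀` the partial differential in the
unknown is invertible, and `HasLeftSeries.exists_implicit` gives a unique continuous solution `g₀`
over a neighbourhood of `x₀`, by a quantitative inversion uniform in the parameter. Shrinking yields
a neighbourhood `W` that is star-shaped about `x₀`.

The same `W` serves all levels. By `exists_continuousOn_lift`, `g₀` takes its values in the image of
each injective map `ρ i₀ j`. Along a segment from `x₀` the parameters whose values lift form a
relatively open set, by the implicit function theorem at level `j` and the inherited invertibility.
The condition on limits of solutions forbids a first parameter where lifting fails. The lifts are
coherent, so they define `g : W → E`.

Smoothness is checked level by level (`IsLCSProjLimit.exists_hasLeftSeries`): above `i₀` the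
differentials at different levels correspond under the injective transition maps, and each zero
neighbourhood of `E` contains the preimage of one from a single level. At a fixed level
(`HasLeftSeries.exists_hasLeftSeries_implicit`) the solution is restricted to finite-dimensional
slices of the parameter space. There it is classically differentiable, and differentiating the
identity `f (x, g x) = 0` by the Faà di Bruno formula expresses each differential of `g` through
lower ones. This recursive formula makes sense on all of `E`, and Keller's convergence passes
through it because the values are normed. -/

set_option linter.unusedSectionVars false

/-! ### Keller differentials with the new direction in front -/

section LeftSeries

variable (𝕜 : Type) [RCLike 𝕜]
  {E : Type uE} [AddCommGroup E] [Module 𝕜 E] [TopologicalSpace E]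
  {F : Type uF} [AddCommGroup F] [Module 𝕜 F] [TopologicalSpace F]

/-- Keller's convergence `Π` of a family of maps in `n` variables along a filter. -/
def PiTendsto {X : Type*} {n : ℕ} (a : Filter X) (Φ : X → (Fin n → E) → F)
    (Φ₀ : (Fin n → E) → F) : Prop :=
  ∀ W ∈ 𝓝 (0 : F), ∃ U ∈ 𝓝 (0 : E), ∀ ε : ℝ, 0 < ε → ∀ᶠ v in a,
    ∀ u : Fin n → E, (∀ i, u i ∈ U) → ∃ w ∈ W, Φ v u - Φ₀ u = (ε : 𝕜) • w

/-- The variant of `HasKellerSeries` in which the new direction of differentiation is inserted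
at the first place, as in `HasFTaylorSeriesUpToOn`. -/
structure HasLeftSeries (k : ℕ∞) (Ω : Set E) (f : E → F)
    (D : ∀ l : ℕ, E → ContinuousMultilinearMap 𝕜 (fun _ : Fin l => E) F) : Prop where
  zero_eq : ∀ x ∈ Ω, ∀ u : Fin 0 → E, D 0 x u = f x
  dirDeriv : ∀ l : ℕ, (l : ℕ∞) < k → ∀ x ∈ Ω, ∀ (u : Fin l → E) (h : E),
    Tendsto (fun t : 𝕜 => t⁻¹ • (D l (x + t • h) u - D l x u)) (𝓝[≠] 0)
      (𝓝 (D (l + 1) x (Fin.cons h u)))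
  piTendsto : ∀ l : ℕ, (l : ℕ∞) ≤ k → ∀ x ∈ Ω, PiTendsto 𝕜 (𝓝 x) (fun x => ⇑(D l x)) (D l x)

variable {𝕜}

theorem PiTendsto.comp_tendsto {X Y : Type*} {n : ℕ} {a : Filter X} {b : Filter Y}
    {Φ : X → (Fin n → E) → F} {Φ₀ : (Fin n → E) → F} (h : PiTendsto 𝕜 a Φ Φ₀) {m : Y → X}
    (hm : Tendsto m b a) : PiTendsto 𝕜 b (fun y => Φ (m y)) Φ₀ := fun W hW =>
  let ⟨U, hU, h⟩ := h W hW
  ⟨U, hU, fun ε hε => hm.eventually (h ε hε)⟩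

theorem PiTendsto.congr {X : Type*} {n : ℕ} {a : Filter X}
    {Φ Ψ : X → (Fin n → E) → F} {Φ₀ Ψ₀ : (Fin n → E) → F} (h : PiTendsto 𝕜 a Φ Φ₀)
    (h' : ∀ x u, Φ x u - Φ₀ u = Ψ x u - Ψ₀ u) : PiTendsto 𝕜 a Ψ Ψ₀ := fun W hW =>
  let ⟨U, hU, h⟩ := h W hW
  ⟨U, hU, fun ε hε => (h ε hε).mono fun x hx u hu => by rw [← h']; exact hx u hu⟩

theorem PiTendsto.reindex {X : Type*} {n : ℕ} {a : Filter X}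
    {Φ : X → (Fin n → E) → F} {Φ₀ : (Fin n → E) → F} (h : PiTendsto 𝕜 a Φ Φ₀)
    (e : Fin n → Fin n) : PiTendsto 𝕜 a (fun x u => Φ x (fun i => u (e i)))
      (fun u => Φ₀ (fun i => u (e i))) := fun W hW =>
  let ⟨U, hU, h⟩ := h W hW
  ⟨U, hU, fun ε hε => (h ε hε).mono fun _ hx u hu => hx (fun i => u (e i)) fun i => hu (e i)⟩

theorem piTendsto_nhds_iff [IsTopologicalAddGroup E] {n : ℕ} {Φ : E → (Fin n → E) → F}
    {Φ₀ : (Fin n → E) → F} {Ω : Set E} (hΩ : IsOpen Ω) {x : E} (hx : x ∈ Ω) :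
    PiTendsto 𝕜 (𝓝 x) Φ Φ₀ ↔ ∀ W ∈ 𝓝 (0 : F), ∃ U ∈ 𝓝 (0 : E),
    ∀ ε : ℝ, 0 < ε → ∃ V ∈ 𝓝 (0 : E), ∀ v ∈ V, x + v ∈ Ω ∧
      ∀ u : Fin n → E, (∀ i, u i ∈ U) → ∃ w ∈ W, Φ (x + v) u - Φ₀ u = (ε : 𝕜) • w := by
  have hmap : 𝓝 x = map (fun v => x + v) (𝓝 0) := by simp
  have hΩ' : ∀ᶠ v in 𝓝 (0 : E), x + v ∈ Ω := by
    have := hΩ.mem_nhds hx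
    rwa [hmap] at this
  refine forall₂_congr fun W hW => exists_congr fun U => and_congr_right fun hU =>
    forall₂_congr fun ε hε => ?_
  rw [hmap, eventually_map]
  constructor
  · intro h
    exact ⟨_, inter_mem hΩ' h, fun v hv => hv⟩
  · rintro ⟨V, hV, h⟩
    filter_upwards [hV] with v hv using (h v hv).2

/-- The two conventions differ by reversing the order of all arguments, so no symmetry of the
differentials has to be proved. -/
theorem isKeller_iff_left [IsTopologicalAddGroup E] {k : ℕ∞} {Ω : Set E} {f : E → F} :
    IsKeller 𝕜 k Ω f ↔ IsOpen Ω ∧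
      ∃ D : ∀ l : ℕ, E → ContinuousMultilinearMap 𝕜 (fun _ : Fin l => E) F,
        HasLeftSeries 𝕜 k Ω f D := by
  refine and_congr_right fun hΩ => ⟨?_, ?_⟩
  · rintro ⟨D, hD⟩
    refine ⟨fun l x => (D l x).domDomCongr Fin.revPerm, ?_, ?_, ?_⟩
    · intro x hx u
      exact hD.zero_eq x hx _
    · intro l hl x hx u h
      have := hD.dirDeriv l hl x hx (u ∘ Fin.rev) h
      rw [← Fin.cons_comp_rev (α := E) h u] at this
      exact this
    · intro l hl x hx
      exact ((piTendsto_nhds_iff hΩ hx).2 (hD.cont l hl x hx)).reindex Fin.rev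
  · rintro ⟨D, hD⟩
    refine ⟨fun l x => (D l x).domDomCongr Fin.revPerm, ?_, ?_, ?_⟩
    · intro x hx u
      exact hD.zero_eq x hx _
    · intro l hl x hx u h
      have := hD.dirDeriv l hl x hx (u ∘ Fin.rev) h
      rw [← Fin.snoc_comp_rev (α := E) h u] at this
      exact this
    · intro l hl x hx
      exact (piTendsto_nhds_iff hΩ hx).1 ((hD.piTendsto l hl x hx).reindex Fin.rev)

namespace HasLeftSeries

variable {k : ℕ∞} {Ω : Set E} {f : E → F}
  {D : ∀ l : ℕ, E → ContinuousMultilinearMap 𝕜 (fun _ : Fin l => E) F}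

theorem mono (h : HasLeftSeries 𝕜 k Ω f D) {Ω' : Set E} (hΩ : Ω' ⊆ Ω) :
    HasLeftSeries 𝕜 k Ω' f D :=
  ⟨fun x hx => h.zero_eq x (hΩ hx), fun l hl x hx => h.dirDeriv l hl x (hΩ hx),
    fun l hl x hx => h.piTendsto l hl x (hΩ hx)⟩

theorem congr (h : HasLeftSeries 𝕜 k Ω f D) {f' : E → F} (hf : ∀ x ∈ Ω, f' x = f x) :
    HasLeftSeries 𝕜 k Ω f' D :=
  ⟨fun x hx u => by rw [hf x hx]; exact h.zero_eq x hx u, h.dirDeriv, h.piTendsto⟩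

theorem add_const [ContinuousAdd F] (h : HasLeftSeries 𝕜 k Ω f D) (c : F) :
    ∃ D', HasLeftSeries 𝕜 k Ω (fun x => f x + c) D' := by
  refine ⟨fun l x => match l with
    | 0 => D 0 x + ContinuousMultilinearMap.constOfIsEmpty 𝕜 _ c
    | l + 1 => D (l + 1) x, ?_, ?_, ?_⟩
  · intro x hx u
    simp [h.zero_eq x hx]
  · rintro (_ | l) hl x hx u v
    · simpa using h.dirDeriv 0 hl x hx u v
    · exact h.dirDeriv (l + 1) hl x hx u v
  · rintro (_ | l) hl x hx
    · exact (h.piTendsto 0 hl x hx).congr fun y u => by simp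
    · exact h.piTendsto (l + 1) hl x hx

theorem comp_affine {E' : Type*} [AddCommGroup E'] [Module 𝕜 E'] [TopologicalSpace E']
    (h : HasLeftSeries 𝕜 k Ω f D) [ContinuousAdd E] (a : E) (L : E' →L[𝕜] E) :
    HasLeftSeries 𝕜 k ((fun x => a + L x) ⁻¹' Ω) (fun x => f (a + L x))
      (fun l x => (D l (a + L x)).compContinuousLinearMap (fun _ => L)) := by
  refine ⟨fun x hx u => h.zero_eq _ hx _, fun l hl x hx u v => ?_, fun l hl x hx => ?_⟩
  · have := h.dirDeriv l hl _ hx (fun i => L (u i)) (L v)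
    simp only [ContinuousMultilinearMap.compContinuousLinearMap_apply]
    convert this using 2
    · simp [add_assoc]
    · congr 1
      ext i
      refine Fin.cases ?_ (fun i => ?_) i <;> simp
  · have hc : Tendsto (fun x => a + L x) (𝓝 x) (𝓝 (a + L x)) :=
      (continuous_const.add L.continuous).continuousAt
    intro W hW
    obtain ⟨U, hU, h⟩ := h.piTendsto l hl _ hx W hW
    refine ⟨L ⁻¹' U, L.continuous.continuousAt.preimage_mem_nhds (by simpa using hU),
      fun ε hε => (hc.eventually (h ε hε)).mono fun y hy u hu => hy _ hu⟩

theorem continuousAt [ContinuousConstSMul 𝕜 F] [IsTopologicalAddGroup F] (hΩ : IsOpen Ω)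
    (h : HasLeftSeries 𝕜 k Ω f D) {x : E} (hx : x ∈ Ω) : ContinuousAt f x := by
  have key : Tendsto (fun y => f y - f x) (𝓝 x) (𝓝 0) := by
    intro W hW
    obtain ⟨U, hU, h'⟩ := h.piTendsto 0 (by simp) x hx W hW
    rw [mem_map]
    filter_upwards [h' 1 one_pos, hΩ.mem_nhds hx] with y hy hyΩ
    obtain ⟨w, hw, e⟩ := hy Fin.elim0 (fun i => i.elim0)
    rw [h.zero_eq x hx, h.zero_eq y hyΩ] at e
    simp only [RCLike.ofReal_one, one_smul] at e
    simpa [e] using hw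
  simpa [ContinuousAt] using key.add_const (f x)

theorem dirDeriv_zero [IsTopologicalAddGroup E] [ContinuousSMul 𝕜 E] (hΩ : IsOpen Ω)
    (h : HasLeftSeries 𝕜 k Ω f D) (hk : 1 ≤ k) {x : E} (hx : x ∈ Ω) (v : E) :
    Tendsto (fun t : 𝕜 => t⁻¹ • (f (x + t • v) - f x)) (𝓝[≠] 0)
      (𝓝 (D 1 x (fun _ => v))) := by
  have h1 := h.dirDeriv 0 (by simpa using lt_of_lt_of_le one_pos hk) x hx Fin.elim0 v
  have e : (Fin.cons v Fin.elim0 : Fin 1 → E) = fun _ => v := by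
    ext i; fin_cases i; rfl
  have h2 : ∀ᶠ t : 𝕜 in 𝓝[≠] 0, x + t • v ∈ Ω := by
    have : ContinuousAt (fun t : 𝕜 => x + t • v) 0 := by fun_prop
    exact (this.mono_left nhdsWithin_le_nhds) (hΩ.mem_nhds (by simpa using hx))
  change Tendsto _ _ (𝓝 (D 1 x (Fin.cons v Fin.elim0))) at h1
  rw [e] at h1
  refine h1.congr' ?_
  filter_upwards [h2] with t ht
  rw [h.zero_eq x hx, h.zero_eq _ ht]

end HasLeftSeries

end LeftSeries

/-! ### Normed spaces: from Keller differentials to Fréchet Taylor series -/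

section Normed

variable {𝕜 : Type} [RCLike 𝕜]

theorem piTendsto_iff_norm {E : Type*} [AddCommGroup E] [TopologicalSpace E]
    {F : Type*} [NormedAddCommGroup F] [NormedSpace 𝕜 F] {X : Type*} {n : ℕ} {a : Filter X}
    {Φ : X → (Fin n → E) → F} {Φ₀ : (Fin n → E) → F} :
    PiTendsto 𝕜 a Φ Φ₀ ↔ ∃ U ∈ 𝓝 (0 : E), ∀ ε : ℝ, 0 < ε → ∀ᶠ v in a,
      ∀ u : Fin n → E, (∀ i, u i ∈ U) → ‖Φ v u - Φ₀ u‖ ≤ ε := by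
  constructor
  · intro h
    obtain ⟨U, hU, h⟩ := h _ (Metric.ball_mem_nhds 0 one_pos)
    refine ⟨U, hU, fun ε hε => (h ε hε).mono fun v hv u hu => ?_⟩
    obtain ⟨w, hw, e⟩ := hv u hu
    rw [e, norm_smul, RCLike.norm_ofReal, abs_of_pos hε]
    rw [mem_ball_zero_iff] at hw
    nlinarith
  · rintro ⟨U, hU, h⟩ W hW
    obtain ⟨r, hr, hrW⟩ := Metric.mem_nhds_iff.1 hW
    refine ⟨U, hU, fun ε hε => (h (ε * (r / 2)) (by positivity)).mono fun v hv u hu => ?_⟩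
    refine ⟨(ε : 𝕜)⁻¹ • (Φ v u - Φ₀ u), hrW ?_, ?_⟩
    · rw [mem_ball_zero_iff, norm_smul, norm_inv, RCLike.norm_ofReal, abs_of_pos hε]
      have := hv u hu
      calc ε⁻¹ * ‖Φ v u - Φ₀ u‖ ≤ ε⁻¹ * (ε * (r / 2)) := by gcongr
        _ = r / 2 := by field_simp
        _ < r := by linarith
    · rw [smul_smul, mul_inv_cancel₀ (by exact_mod_cast hε.ne'), one_smul]

variable {E : Type*} [NormedAddCommGroup E] [NormedSpace 𝕜 E]
  {F : Type*} [NormedAddCommGroup F] [NormedSpace 𝕜 F]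

/-- By homogeneity each nonzero argument may be rescaled to norm `r`; if some argument is zero, so
is the value. -/
theorem ContinuousMultilinearMap.opNorm_le_of_forall_norm_le {n : ℕ}
    (Φ : ContinuousMultilinearMap 𝕜 (fun _ : Fin n => E) F) {r ε : ℝ} (hr : 0 < r) (hε : 0 ≤ ε)
    (h : ∀ u : Fin n → E, (∀ i, ‖u i‖ ≤ r) → ‖Φ u‖ ≤ ε) : ‖Φ‖ ≤ ε / r ^ n := by
  refine Φ.opNorm_le_bound (by positivity) fun u => ?_
  by_cases hu : ∃ i, u i = 0
  · obtain ⟨i, hi⟩ := hu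
    rw [Φ.map_coord_zero i hi, norm_zero]
    positivity
  · push Not at hu
    have hu' : ∀ i, 0 < ‖u i‖ := fun i => norm_pos_iff.2 (hu i)
    have h1 := h (fun i => ((r / ‖u i‖ : ℝ) : 𝕜) • u i) fun i => by
      rw [norm_smul, RCLike.norm_ofReal, abs_of_pos (div_pos hr (hu' i)),
        div_mul_cancel₀ _ (hu' i).ne']
    rw [Φ.map_smul_univ, norm_smul, norm_prod] at h1
    have h2 : ∏ i, ‖((r / ‖u i‖ : ℝ) : 𝕜)‖ = r ^ n / ∏ i, ‖u i‖ := by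
      simp_rw [RCLike.norm_ofReal, abs_of_pos (div_pos hr (hu' _))]
      rw [Finset.prod_div_distrib]
      simp
    have h3 : 0 < ∏ i, ‖u i‖ := Finset.prod_pos fun i _ => hu' i
    rw [h2, div_mul_eq_mul_div, div_le_iff₀ h3] at h1
    rw [div_mul_eq_mul_div, le_div_iff₀ (by positivity)]
    linarith

theorem PiTendsto.tendsto {X : Type*} {n : ℕ} {a : Filter X}
    {Φ : X → ContinuousMultilinearMap 𝕜 (fun _ : Fin n => E) F}
    {Φ₀ : ContinuousMultilinearMap 𝕜 (fun _ : Fin n => E) F}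
    (h : PiTendsto 𝕜 a (fun x => ⇑(Φ x)) Φ₀) : Tendsto Φ a (𝓝 Φ₀) := by
  obtain ⟨U, hU, h⟩ := piTendsto_iff_norm.1 h
  obtain ⟨r, hr, hrU⟩ := Metric.nhds_basis_closedBall.mem_iff.1 hU
  rw [Metric.nhds_basis_closedBall.tendsto_right_iff]
  intro ε hε
  refine (h (ε * r ^ n) (by positivity)).mono fun x hx => ?_
  rw [mem_closedBall_iff_norm]
  refine (ContinuousMultilinearMap.opNorm_le_of_forall_norm_le _ hr (by positivity)
    (fun u hu => hx u fun i => hrU ?_)).trans_eq (by field_simp)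
  simpa using hu i

/-- Directional derivatives that depend continuously on the point in operator norm are Fréchet
derivatives, by the mean value inequality on segments. -/
theorem HasLeftSeries.hasFDerivAt {k : ℕ∞} {Ω : Set E} {f : E → F}
    {D : ∀ l : ℕ, E → ContinuousMultilinearMap 𝕜 (fun _ : Fin l => E) F}
    (h : HasLeftSeries 𝕜 k Ω f D) (hΩ : IsOpen Ω) {l : ℕ} (hl : (l : ℕ∞) < k) {x : E}
    (hx : x ∈ Ω) : HasFDerivAt (D l) (D (l + 1) x).curryLeft x := by
  let _ : NormedSpace ℝ F := NormedSpace.restrictScalars ℝ 𝕜 F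
  have : IsScalarTower ℝ 𝕜 F := RestrictScalars.isScalarTower ℝ 𝕜 F
  have hD : Tendsto (D (l + 1)) (𝓝 x) (𝓝 (D (l + 1) x)) :=
    (h.piTendsto (l + 1) (by exact_mod_cast Order.add_one_le_of_lt hl) x hx).tendsto
  rw [hasFDerivAt_iff_isLittleO_nhds_zero, Asymptotics.isLittleO_iff]
  intro ε hε
  have h1 : ∀ᶠ y in 𝓝 x, y ∈ Ω ∧ ‖D (l + 1) y - D (l + 1) x‖ ≤ ε := by
    filter_upwards [hΩ.mem_nhds hx, hD (Metric.closedBall_mem_nhds _ hε)] with y hy hy'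
    exact ⟨hy, mem_closedBall_iff_norm.1 hy'⟩
  obtain ⟨r, hr, hr'⟩ := Metric.eventually_nhds_iff_ball.1 h1
  filter_upwards [Metric.ball_mem_nhds (0 : E) hr] with v hv
  rw [mem_ball_zero_iff] at hv
  refine ContinuousMultilinearMap.opNorm_le_bound (by positivity) fun u => ?_
  have hmem : ∀ t ∈ Set.Icc (0 : ℝ) 1, x + (t : 𝕜) • v ∈ Metric.ball x r := by
    intro t ht
    rw [mem_ball_iff_norm, add_sub_cancel_left, norm_smul, RCLike.norm_ofReal, abs_of_nonneg ht.1]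
    nlinarith [norm_nonneg v, ht.2]
  -- With the linear part removed, the derivative along the segment is `D (l + 1) (x + t v) - D (l +
  -- 1) x` at `(v, u)`, which is at most `ε * ‖v‖ * ∏ ‖u i‖`. The estimate is uniform in `u`, so it
  -- bounds the operator norm of the remainder.
  have hder : ∀ t ∈ Set.Icc (0 : ℝ) 1, HasDerivWithinAt
      (fun t : ℝ => D l (x + (t : 𝕜) • v) u - (t : 𝕜) • D (l + 1) x (Fin.cons v u))
      (D (l + 1) (x + (t : 𝕜) • v) (Fin.cons v u) - D (l + 1) x (Fin.cons v u))
      (Set.Icc 0 1) t := by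
    intro t ht
    have h2 : HasDerivAt (fun s : 𝕜 => D l (x + s • v) u)
        (D (l + 1) (x + (t : 𝕜) • v) (Fin.cons v u)) (t : 𝕜) := by
      rw [hasDerivAt_iff_tendsto_slope_zero]
      refine (h.dirDeriv l hl _ (hr' _ (hmem t ht)).1 u v).congr fun s => ?_
      rw [add_smul, add_assoc]
    have h3 : HasDerivAt (fun s : 𝕜 => D l (x + s • v) u - s • D (l + 1) x (Fin.cons v u))
        (D (l + 1) (x + (t : 𝕜) • v) (Fin.cons v u) - D (l + 1) x (Fin.cons v u)) (t : 𝕜) := by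
      simpa using h2.fun_sub ((hasDerivAt_id' (t : 𝕜)).smul_const (D (l + 1) x (Fin.cons v u)))
    have h4 : HasDerivAt (fun t : ℝ => (t : 𝕜)) 1 t := by
      simpa using (RCLike.ofRealCLM (K := 𝕜)).hasDerivAt (x := t)
    simpa [Function.comp_def] using (h3.scomp t h4).hasDerivWithinAt
  have := norm_image_sub_le_of_norm_deriv_le_segment_01' hder
    (C := ε * ‖v‖ * ∏ i, ‖u i‖) (fun t ht => by
      have ht' := hmem t ⟨ht.1, ht.2.le⟩
      rw [← sub_apply]
      refine (ContinuousMultilinearMap.le_opNorm _ _).trans ?_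
      rw [Fin.prod_univ_succ]
      simp only [Fin.cons_zero, Fin.cons_succ]
      rw [mul_assoc]
      gcongr
      exact (hr' _ ht').2)
  simp only [RCLike.ofReal_one, RCLike.ofReal_zero, one_smul, zero_smul, add_zero, sub_zero] at this
  simp only [sub_apply, ContinuousMultilinearMap.curryLeft_apply]
  refine (le_of_eq ?_).trans this
  congr 1
  abel

theorem HasLeftSeries.hasFTaylorSeriesUpToOn {k : ℕ∞} {Ω : Set E} {f : E → F}
    {D : ∀ l : ℕ, E → ContinuousMultilinearMap 𝕜 (fun _ : Fin l => E) F}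
    (h : HasLeftSeries 𝕜 k Ω f D) (hΩ : IsOpen Ω) :
    HasFTaylorSeriesUpToOn k f (fun x n => D n x) Ω where
  zero_eq x hx := h.zero_eq x hx _
  fderivWithin m hm x hx := (h.hasFDerivAt hΩ (by exact_mod_cast hm) hx).hasFDerivWithinAt
  cont m hm x hx :=
    (h.piTendsto m (by exact_mod_cast hm) x hx).tendsto.mono_left nhdsWithin_le_nhds

end Normed

/-! ### Keller convergence under multilinear composition -/

section Composition

variable {𝕜 : Type} [RCLike 𝕜]
  {E : Type*} [AddCommGroup E] [Module 𝕜 E] [TopologicalSpace E]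
  {Y : Type*} [AddCommGroup Y] [Module 𝕜 Y] [TopologicalSpace Y]
  {Z : Type*} [NormedAddCommGroup Z] [NormedSpace 𝕜 Z]

theorem exists_nhds_forall_mem_of_continuous {n : ℕ} {T : Type*} [TopologicalSpace T]
    {φ : (Fin n → E) → T} (hφ : Continuous φ) {W : Set T} (hW : W ∈ 𝓝 (φ 0)) :
    ∃ U ∈ 𝓝 (0 : E), ∀ u : Fin n → E, (∀ i, u i ∈ U) → φ u ∈ W := by
  have h := hφ.continuousAt (x := 0) hW
  rw [mem_map, nhds_pi, Filter.mem_pi'] at h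
  obtain ⟨I, t, ht, htW⟩ := h
  refine ⟨⋂ i, t i, by simpa using ht, fun u hu => htW fun i _ => ?_⟩
  exact Set.mem_iInter.1 (hu i) i

theorem ContinuousMultilinearMap.exists_nhds_norm_le {n : ℕ}
    (Φ : ContinuousMultilinearMap 𝕜 (fun _ : Fin n => Y) Z) :
    ∃ U ∈ 𝓝 (0 : Y), ∃ C : ℝ, 0 ≤ C ∧ ∀ u : Fin n → Y, (∀ i, u i ∈ U) → ‖Φ u‖ ≤ C := by
  obtain ⟨U, hU, h⟩ := exists_nhds_forall_mem_of_continuous Φ.cont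
    (Metric.ball_mem_nhds (Φ 0) one_pos)
  refine ⟨U, hU, ‖Φ 0‖ + 1, by positivity, fun u hu => ?_⟩
  have := h u hu
  rw [mem_ball_iff_norm] at this
  have h2 := norm_add_le (Φ 0) (Φ u - Φ 0)
  rw [add_sub_cancel] at h2
  exact h2.trans (by gcongr; exact this.le)

/-- Expanding by multilinearity gives one term per subset of the arguments. The full subset
contributes `Φ b`, and every other term carries at least one factor `ε`. -/
theorem ContinuousMultilinearMap.norm_add_smul_sub_le {n : ℕ}
    (Φ : ContinuousMultilinearMap 𝕜 (fun _ : Fin n => Y) Z) {U : Set Y} {C : ℝ} (hC : 0 ≤ C)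
    (hU : ∀ u : Fin n → Y, (∀ i, u i ∈ U) → ‖Φ u‖ ≤ C) {ε : ℝ} (hε : 0 ≤ ε) (hε1 : ε ≤ 1)
    {b w : Fin n → Y} (hb : ∀ i, b i ∈ U) (hw : ∀ i, w i ∈ U) :
    ‖Φ (fun i => b i + (ε : 𝕜) • w i) - Φ b‖ ≤ 2 ^ n * (ε * C) := by
  classical
  have h1 : Φ (fun i => b i + (ε : 𝕜) • w i) =
      ∑ s : Finset (Fin n), Φ (s.piecewise b (fun i => (ε : 𝕜) • w i)) :=
    Φ.toMultilinearMap.map_add_univ b (fun i => (ε : 𝕜) • w i)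
  have h2 : Φ b = Φ ((Finset.univ : Finset (Fin n)).piecewise b (fun i => (ε : 𝕜) • w i)) := by
    simp
  rw [h1, h2, ← Finset.sum_erase_add _ _ (Finset.mem_univ Finset.univ), add_sub_cancel_right]
  refine (norm_sum_le_of_le (n := fun _ => ε * C) _ fun s hs => ?_).trans ?_
  · have hs' : s ≠ Finset.univ := (Finset.mem_erase.1 hs).1
    have h3 : s.piecewise b (fun i => (ε : 𝕜) • w i) =
        sᶜ.piecewise (fun i => (ε : 𝕜) • s.piecewise b w i) (s.piecewise b w) := by
      ext i
      by_cases hi : i ∈ s <;> simp [hi]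
    have h4 : Φ (sᶜ.piecewise (fun i => (ε : 𝕜) • s.piecewise b w i) (s.piecewise b w)) =
        (∏ i ∈ sᶜ, (ε : 𝕜)) • Φ (s.piecewise b w) :=
      Φ.toMultilinearMap.map_piecewise_smul (fun _ => (ε : 𝕜)) (s.piecewise b w) sᶜ
    rw [h3, h4, Finset.prod_const, norm_smul, norm_pow, RCLike.norm_ofReal, abs_of_nonneg hε]
    have h5 : sᶜ.card ≠ 0 := by simpa [Finset.compl_eq_empty_iff] using hs'
    have h6 : ‖Φ (s.piecewise b w)‖ ≤ C := hU _ fun i => by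
      by_cases hi : i ∈ s <;> simp [hi, hb i, hw i]
    have h7 : ε ^ sᶜ.card ≤ ε := pow_le_of_le_one hε hε1 h5
    gcongr
  · rw [Finset.sum_const, nsmul_eq_mul]
    gcongr
    have := Finset.card_erase_le (s := (Finset.univ : Finset (Finset (Fin n))))
      (a := Finset.univ)
    rw [Finset.card_univ, Fintype.card_finset, Fintype.card_fin] at this
    exact_mod_cast this

namespace OrderedFinpartition

variable {n : ℕ} (c : OrderedFinpartition n)

/-- The index `j` lies in exactly one part, so changing the `j`-th argument affects a single inner
map. -/
theorem apply_update (P : ∀ i, (Fin (c.partSize i) → E) → Y) (j : Fin n) (v : Fin n → E) (z : E) :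
    (fun m => P m (Function.update v j z ∘ c.emb m)) =
      Function.update (fun m => P m (v ∘ c.emb m)) (c.index j)
        (P (c.index j) (Function.update (v ∘ c.emb (c.index j)) (c.invEmbedding j) z)) := by
  ext m
  by_cases h : m = c.index j
  · subst h
    rw [Function.update_self, ← Function.update_comp_eq_of_injective]
    · simp
    · exact (c.emb_strictMono (c.index j)).injective
  · rw [Function.update_of_ne h]
    congr 1
    apply Function.update_comp_eq_of_notMem_range
    rintro ⟨a, ha⟩
    exact c.emb_ne_emb_of_ne h (a := a) (b := c.invEmbedding j) (by rw [ha]; simp)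

/-- The composition of continuous multilinear maps along an ordered partition, between arbitrary
topological vector spaces. -/
noncomputable def compAlong {Z : Type*} [AddCommGroup Z] [Module 𝕜 Z] [TopologicalSpace Z]
    (Φ : ContinuousMultilinearMap 𝕜 (fun _ : Fin c.length => Y) Z)
    (P : ∀ i, ContinuousMultilinearMap 𝕜 (fun _ : Fin (c.partSize i) => E) Y) :
    ContinuousMultilinearMap 𝕜 (fun _ : Fin n => E) Z where
  toMultilinearMap :=
    MultilinearMap.mk' (fun v => Φ (fun m => P m (v ∘ c.emb m)))
      (fun v i x y => by
        simp only [c.apply_update (fun i => ⇑(P i)), ContinuousMultilinearMap.map_update_add])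
      (fun v i a x => by
        simp only [c.apply_update (fun i => ⇑(P i)), ContinuousMultilinearMap.map_update_smul])
  cont := by
    apply Φ.cont.comp
    change Continuous (fun (v : Fin n → E) m => P m (v ∘ c.emb m))
    refine continuous_pi fun m => (P m).cont.comp ?_
    exact continuous_pi fun i => continuous_apply _

@[simp]
theorem compAlong_apply {Z : Type*} [AddCommGroup Z] [Module 𝕜 Z] [TopologicalSpace Z]
    (Φ : ContinuousMultilinearMap 𝕜 (fun _ : Fin c.length => Y) Z)
    (P : ∀ i, ContinuousMultilinearMap 𝕜 (fun _ : Fin (c.partSize i) => E) Y) (v : Fin n → E) :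
    c.compAlong Φ P v = Φ (fun m => P m (v ∘ c.emb m)) := rfl

end OrderedFinpartition

/-- The outer maps are compared at the perturbed arguments, and the limit `Φ₀` is then compared at
perturbed and unperturbed arguments. The second comparison uses that `Φ₀` is bounded on a zero
neighbourhood, which holds because its values are normed. -/
theorem PiTendsto.compAlong [IsTopologicalAddGroup Y] [ContinuousSMul 𝕜 Y] {X : Type*}
    {a : Filter X} {n : ℕ} (c : OrderedFinpartition n)
    {Φ : X → ContinuousMultilinearMap 𝕜 (fun _ : Fin c.length => Y) Z}
    {Φ₀ : ContinuousMultilinearMap 𝕜 (fun _ : Fin c.length => Y) Z}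
    {P : X → ∀ i, ContinuousMultilinearMap 𝕜 (fun _ : Fin (c.partSize i) => E) Y}
    {P₀ : ∀ i, ContinuousMultilinearMap 𝕜 (fun _ : Fin (c.partSize i) => E) Y}
    (hΦ : PiTendsto 𝕜 a (fun x => ⇑(Φ x)) Φ₀)
    (hP : ∀ i, PiTendsto 𝕜 a (fun x => ⇑(P x i)) (P₀ i)) :
    PiTendsto 𝕜 a (fun x => ⇑(c.compAlong (Φ x) (P x))) (c.compAlong Φ₀ P₀) := by
  obtain ⟨U₁, hU₁, h₁⟩ := piTendsto_iff_norm.1 hΦ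
  obtain ⟨U₂, hU₂, C, hC, h₂⟩ := Φ₀.exists_nhds_norm_le
  obtain ⟨U₃, hU₃, h₃⟩ := exists_nhds_zero_half (inter_mem hU₁ hU₂)
  obtain ⟨U, ⟨hU, hUb⟩, hUU⟩ := (nhds_basis_balanced 𝕜 Y).mem_iff.1 hU₃
  have hUadd : ∀ v ∈ U, ∀ w ∈ U, v + w ∈ U₁ ∩ U₂ := fun v hv w hw => h₃ v (hUU hv) w (hUU hw)
  have hUsub : ∀ v ∈ U, v ∈ U₁ ∩ U₂ := fun v hv => by
    simpa using hUadd v hv 0 (mem_of_mem_nhds hU)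
  choose V hV h₄ using fun i => hP i U hU
  have h₅ : ∀ i, ∃ V' ∈ 𝓝 (0 : E), ∀ u : Fin (c.partSize i) → E, (∀ j, u j ∈ V') → P₀ i u ∈ U := by
    intro i
    refine exists_nhds_forall_mem_of_continuous (P₀ i).cont ?_
    -- Parts are nonempty, so `P₀ i` vanishes at zero; a multilinear map in no variables need not.
    have : Nonempty (Fin (c.partSize i)) := ⟨⟨0, c.partSize_pos i⟩⟩
    have h0 : P₀ i 0 = 0 := (P₀ i).map_zero
    change U ∈ 𝓝 (P₀ i 0)
    rwa [h0]
  choose V' hV' h₅ using h₅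
  rw [piTendsto_iff_norm]
  refine ⟨⋂ i, V i ∩ V' i, Filter.iInter_mem.2 fun i => inter_mem (hV i) (hV' i),
    fun ε hε => ?_⟩
  -- The zero neighbourhood is fixed before `ε`, as Keller's condition demands; only `δ` depends on
  -- `ε`. The summand `1` keeps `K` positive, and `δ ≤ 1` keeps `δ • w i` in the balanced set `U`.
  set K : ℝ := 2 ^ c.length * C + 1 with hK
  have hKpos : 0 < K := by positivity
  set δ : ℝ := min 1 (ε / 2 / K) with hδ
  have hδpos : 0 < δ := by positivity
  have hδK : δ * K ≤ ε / 2 := by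
    rw [← le_div_iff₀ hKpos]
    exact min_le_right _ _
  filter_upwards [h₁ (ε / 2) (by positivity), eventually_all.2 fun i => h₄ i δ hδpos]
    with x hx₁ hx₂ u hu
  have hu' : ∀ i (j : Fin (c.partSize i)), (u ∘ c.emb i) j ∈ V i ∩ V' i := fun i j =>
    Set.mem_iInter.1 (hu _) i
  choose w hw hwe using fun i => hx₂ i (u ∘ c.emb i) fun j => (hu' i j).1
  have hb : ∀ i, P₀ i (u ∘ c.emb i) ∈ U := fun i => h₅ i _ fun j => (hu' i j).2
  have he : (fun i => P x i (u ∘ c.emb i)) =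
      fun i => P₀ i (u ∘ c.emb i) + (δ : 𝕜) • w i := by
    ext i
    rw [← hwe i]
    abel
  simp only [OrderedFinpartition.compAlong_apply]
  rw [he]
  have hδw : ∀ i, (δ : 𝕜) • w i ∈ U := fun i => hUb.smul_mem (by
    rw [RCLike.norm_ofReal, abs_of_pos hδpos]; exact min_le_left _ _) (hw i)
  have e₁ := hx₁ (fun i => P₀ i (u ∘ c.emb i) + (δ : 𝕜) • w i)
    fun i => (hUadd _ (hb i) _ (hδw i)).1
  have e₂ := Φ₀.norm_add_smul_sub_le hC h₂ hδpos.le (min_le_left _ _)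
    (fun i => (hUsub _ (hb i)).2) (fun i => (hUsub _ (hw i)).2)
  refine (norm_sub_le_norm_sub_add_norm_sub _ _ _).trans ((add_le_add e₁ e₂).trans ?_)
  have : 2 ^ c.length * (δ * C) ≤ δ * K := by
    rw [hK]; nlinarith
  linarith

theorem PiTendsto.sum {X : Type*} {a : Filter X} {n : ℕ} {ι : Type*} [Fintype ι]
    {Φ : ι → X → (Fin n → E) → Z} {Φ₀ : ι → (Fin n → E) → Z}
    (h : ∀ i, PiTendsto 𝕜 a (Φ i) (Φ₀ i)) :
    PiTendsto 𝕜 a (fun x u => ∑ i, Φ i x u) (fun u => ∑ i, Φ₀ i u) := by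
  choose U hU h using fun i => piTendsto_iff_norm.1 (h i)
  rw [piTendsto_iff_norm]
  refine ⟨⋂ i, U i, Filter.iInter_mem.2 hU, fun ε hε => ?_⟩
  have hpos : (0 : ℝ) < Fintype.card ι + 1 := by positivity
  filter_upwards [eventually_all.2 fun i => h i (ε / (Fintype.card ι + 1)) (by positivity)]
    with x hx u hu
  rw [← Finset.sum_sub_distrib]
  refine (norm_sum_le_of_le _ fun i _ => hx i u fun j => Set.mem_iInter.1 (hu j) i).trans ?_
  rw [Finset.sum_const, Finset.card_univ, nsmul_eq_mul, mul_div_assoc', div_le_iff₀ hpos]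
  nlinarith

/-- This serves to apply the inverse of the partial differential, which varies continuously in
operator norm. -/
theorem PiTendsto.clm_apply {Z' : Type*} [NormedAddCommGroup Z'] [NormedSpace 𝕜 Z']
    {X : Type*} {a : Filter X} {n : ℕ} {T : X → Z →L[𝕜] Z'} {T₀ : Z →L[𝕜] Z'}
    (hT : Tendsto T a (𝓝 T₀)) {Φ : X → (Fin n → E) → Z}
    {Φ₀ : ContinuousMultilinearMap 𝕜 (fun _ : Fin n => E) Z}
    (h : PiTendsto 𝕜 a Φ Φ₀) :
    PiTendsto 𝕜 a (fun x u => T x (Φ x u)) (fun u => T₀ (Φ₀ u)) := by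
  obtain ⟨U, hU, h⟩ := piTendsto_iff_norm.1 h
  obtain ⟨U₂, hU₂, C, hC, h₂⟩ := Φ₀.exists_nhds_norm_le
  rw [piTendsto_iff_norm]
  refine ⟨U ∩ U₂, inter_mem hU hU₂, fun ε hε => ?_⟩
  set K : ℝ := ‖T₀‖ + 1 + C with hK
  have hKpos : 0 < K := by positivity
  set δ : ℝ := min 1 (ε / K) with hδ
  have hδpos : 0 < δ := by positivity
  have hδK : δ * K ≤ ε := by
    rw [← le_div_iff₀ hKpos]
    exact min_le_right _ _
  filter_upwards [h δ hδpos, hT (Metric.closedBall_mem_nhds _ hδpos)] with x hx hTx u hu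
  have hTx' : ‖T x - T₀‖ ≤ δ := mem_closedBall_iff_norm.1 hTx
  have e : T x (Φ x u) - T₀ (Φ₀ u) = T x (Φ x u - Φ₀ u) + (T x - T₀) (Φ₀ u) := by
    simp
  have hTn : ‖T x‖ ≤ ‖T₀‖ + 1 := by
    have := norm_add_le T₀ (T x - T₀)
    rw [add_sub_cancel] at this
    exact this.trans (by gcongr; exact hTx'.trans (min_le_left _ _))
  rw [e]
  calc _ ≤ ‖T x‖ * ‖Φ x u - Φ₀ u‖ + ‖T x - T₀‖ * ‖Φ₀ u‖ :=
        (norm_add_le _ _).trans (add_le_add (ContinuousLinearMap.le_opNorm _ _)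
          (ContinuousLinearMap.le_opNorm _ _))
    _ ≤ (‖T₀‖ + 1) * δ + δ * C := by
        gcongr
        · exact hx u fun i => (hu i).1
        · exact h₂ u fun i => (hu i).2
    _ = δ * K := by rw [hK]; ring
    _ ≤ ε := hδK

theorem PiTendsto.const_prodMk {X : Type*} {a : Filter X} {n : ℕ} (ψ : (Fin n → E) → Y)
    {Φ : X → (Fin n → E) → Z} {Φ₀ : (Fin n → E) → Z} (h : PiTendsto 𝕜 a Φ Φ₀) :
    PiTendsto 𝕜 a (fun x u => (ψ u, Φ x u)) (fun u => (ψ u, Φ₀ u)) := by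
  intro W hW
  have hW' : {z : Z | ((0 : Y), z) ∈ W} ∈ 𝓝 (0 : Z) :=
    (Continuous.prodMk_right (0 : Y)).continuousAt hW
  obtain ⟨U, hU, h⟩ := h _ hW'
  refine ⟨U, hU, fun ε hε => (h ε hε).mono fun x hx u hu => ?_⟩
  obtain ⟨w, hw, e⟩ := hx u hu
  exact ⟨(0, w), hw, by simp [e]⟩

theorem PiTendsto.const {X : Type*} {a : Filter X} {n : ℕ} (Φ : (Fin n → E) → Y) :
    PiTendsto 𝕜 a (fun _ => Φ) Φ := fun W hW =>
  ⟨Set.univ, univ_mem, fun _ _ => Eventually.of_forall fun _ u _ =>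
    ⟨0, mem_of_mem_nhds hW, by simp⟩⟩

end Composition

/-! ### Ordered partitions: isolating the term of top order -/

namespace OrderedFinpartition

/-- The partition of `Fin n` into a single part. -/
def indiscrete (n : ℕ) (hn : 0 < n) : OrderedFinpartition n where
  length := 1
  partSize _ := n
  partSize_pos _ := hn
  emb _ i := i
  emb_strictMono _ := strictMono_id
  parts_strictMono := Subsingleton.strictMono _
  disjoint _ _ _ _ h := (h (Subsingleton.elim _ _)).elim
  cover x := ⟨0, x, rfl⟩

theorem eq_indiscrete {n : ℕ} (hn : 0 < n) (c : OrderedFinpartition n) (i : Fin c.length)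
    (hi : c.partSize i = n) : c = indiscrete n hn := by
  have hsum : ∑ m, c.partSize m = n := by
    simpa using c.sum_sigma_eq_sum (fun _ => (1 : ℕ))
  have hone : ∀ m, m = i := by
    intro m
    by_contra hm
    have h1 : ∑ m ∈ ({m, i} : Finset _), c.partSize m ≤ ∑ m, c.partSize m :=
      Finset.sum_le_univ_sum_of_nonneg fun _ => Nat.zero_le _
    rw [Finset.sum_pair hm, hsum, hi] at h1
    have := c.partSize_pos m
    omega
  have hlen : c.length = 1 := by
    have : Subsingleton (Fin c.length) := ⟨fun a b => (hone a).trans (hone b).symm⟩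
    have h1 := Fintype.card_le_one_iff_subsingleton.2 this
    rw [Fintype.card_fin] at h1
    have := i.pos
    omega
  obtain ⟨length, partSize, pos, emb, emb_mono, parts, disj, cov⟩ := c
  dsimp only at *
  subst hlen
  have hp : partSize = fun _ => n := by
    ext m
    rw [hone m, hi]
  subst hp
  have he : emb = fun _ i => i := by
    funext m
    -- A strictly monotone self-map of `Fin n` is surjective, hence has the range of the identity
    -- and equals it.
    exact (emb_mono m).range_inj strictMono_id |>.1 (by
      rw [((Finite.injective_iff_surjective).1 (emb_mono m).injective).range_eq, Set.range_id])
  subst he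
  rfl

/-- Only the partition with a single part sees the inner map of order `n`, so in the Faà di Bruno
sum the top order enters additively, through `q 1`. This is what allows solving for it. -/
theorem sum_eq_sum_add {E Y Z : Type*} [AddCommGroup Y] [AddCommGroup Z] {n : ℕ} (hn : 0 < n)
    (q : ∀ l, (Fin l → Y) → Z) (hq : ∀ a b : Fin 1 → Y, q 1 (a + b) = q 1 a + q 1 b)
    (p p' : ∀ j, (Fin j → E) → Y) (v : Fin n → E) (r : Y)
    (hlt : ∀ j, 0 < j → j < n → ∀ u, p j u = p' j u) (htop : p n v = p' n v + r) :
    ∑ c : OrderedFinpartition n, q c.length (fun i => p (c.partSize i) (v ∘ c.emb i)) =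
      ∑ c : OrderedFinpartition n, q c.length (fun i => p' (c.partSize i) (v ∘ c.emb i)) +
        q 1 (fun _ => r) := by
  classical
  rw [← Finset.add_sum_erase _ _ (Finset.mem_univ (indiscrete n hn)),
    ← Finset.add_sum_erase (f := fun c : OrderedFinpartition n =>
      q c.length (fun i => p' (c.partSize i) (v ∘ c.emb i))) _
      (Finset.mem_univ (indiscrete n hn))]
  have h1 : q (indiscrete n hn).length
      (fun i => p ((indiscrete n hn).partSize i) (v ∘ (indiscrete n hn).emb i)) =
      q (indiscrete n hn).length
      (fun i => p' ((indiscrete n hn).partSize i) (v ∘ (indiscrete n hn).emb i)) +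
        q 1 (fun _ => r) := by
    change q 1 (fun _ => p n v) = q 1 (fun _ => p' n v) + q 1 (fun _ => r)
    rw [htop, ← hq]
    rfl
  have h2 : ∀ c ∈ Finset.univ.erase (indiscrete n hn),
      q c.length (fun i => p (c.partSize i) (v ∘ c.emb i)) =
        q c.length (fun i => p' (c.partSize i) (v ∘ c.emb i)) := by
    intro c hc
    congr 1
    ext i
    refine hlt _ (c.partSize_pos i) (lt_of_le_of_ne (c.partSize_le i) fun h => ?_) _
    exact (Finset.mem_erase.1 hc).1 (eq_indiscrete hn c i h)
  rw [h1, Finset.sum_congr rfl h2]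
  abel

end OrderedFinpartition

/-! ### Differentials of the identity -/

section Identity

variable (𝕜 : Type) [RCLike 𝕜] {E : Type*} [AddCommGroup E] [Module 𝕜 E] [TopologicalSpace E]

/-- The sequence of the iterated differentials of the identity. -/
def idSeries (x : E) : ∀ n : ℕ, ContinuousMultilinearMap 𝕜 (fun _ : Fin n => E) E
  | 0 => ContinuousMultilinearMap.constOfIsEmpty 𝕜 _ x
  | 1 => ContinuousMultilinearMap.ofSubsingleton 𝕜 E E 0 (ContinuousLinearMap.id 𝕜 E)
  | _ + 2 => 0

variable {𝕜}

theorem map_idSeries {E' : Type*} [AddCommGroup E'] [Module 𝕜 E'] [TopologicalSpace E']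
    (L : E →L[𝕜] E') (n : ℕ) (u : Fin n → E) :
    L (idSeries 𝕜 (0 : E) n u) = idSeries 𝕜 (0 : E') n (fun i => L (u i)) := by
  match n with
  | 0 => simp [idSeries]
  | 1 => simp [idSeries]
  | n + 2 => simp [idSeries]

theorem idSeries_eq (x y : E) {n : ℕ} (hn : 0 < n) : idSeries 𝕜 x n = idSeries 𝕜 y n := by
  match n with
  | 0 => omega
  | 1 => rfl
  | n + 2 => rfl

theorem hasFTaylorSeriesUpToOn_id {E : Type*} [NormedAddCommGroup E] [NormedSpace 𝕜 E]
    (k : ℕ∞) {O : Set E} (hO : IsOpen O) :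
    HasFTaylorSeriesUpToOn k (fun x : E => x) (fun x n => idSeries 𝕜 x n) O := by
  refine HasLeftSeries.hasFTaylorSeriesUpToOn (D := fun n x => idSeries 𝕜 x n)
    ⟨fun x hx u => rfl, ?_, ?_⟩ hO
  · rintro (_ | _ | l) hl x hx u h
    · refine tendsto_const_nhds.congr' ?_
      filter_upwards [self_mem_nhdsWithin] with t ht
      simp [idSeries, smul_smul, inv_mul_cancel₀ (show t ≠ 0 from ht)]
    · simp [idSeries]
    · simp [idSeries]
  · rintro (_ | l) hl x hx
    · rw [piTendsto_iff_norm]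
      refine ⟨Set.univ, univ_mem, fun ε hε => ?_⟩
      filter_upwards [Metric.closedBall_mem_nhds x hε] with y hy u hu
      simpa [idSeries] using mem_closedBall_iff_norm.1 hy
    · have : (fun y : E => ⇑(idSeries 𝕜 y (l + 1))) = fun _ => ⇑(idSeries 𝕜 x (l + 1)) := by
        ext1 y
        rw [idSeries_eq y x (Nat.succ_pos l)]
      rw [this]
      exact PiTendsto.const _

end Identity

/-! ### The partial differential in the Banach variable -/

section PartialTwo

variable {𝕜 : Type} [RCLike 𝕜] {E : Type*} [AddCommGroup E] [Module 𝕜 E] [TopologicalSpace E]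
  {B : Type*} [NormedAddCommGroup B] [NormedSpace 𝕜 B]

/-- The partial differential with respect to the second variable, extracted from a sequence of
differentials. -/
noncomputable def partialTwo
    (D : ∀ l : ℕ, E × B → ContinuousMultilinearMap 𝕜 (fun _ : Fin l => E × B) B) (z : E × B) :
    B →L[𝕜] B :=
  continuousMultilinearCurryFin1 𝕜 B B
    ((D 1 z).compContinuousLinearMap fun _ => ContinuousLinearMap.inr 𝕜 E B)

theorem partialTwo_apply
    (D : ∀ l : ℕ, E × B → ContinuousMultilinearMap 𝕜 (fun _ : Fin l => E × B) B) (z : E × B)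
    (v : B) : partialTwo D z v = D 1 z (fun _ => (0, v)) := by
  simp only [partialTwo, continuousMultilinearCurryFin1_apply,
    ContinuousMultilinearMap.compContinuousLinearMap_apply, ContinuousLinearMap.inr_apply]
  congr 1

variable {k : ℕ∞} {Ω : Set (E × B)} {f : E × B → B}
  {D : ∀ l : ℕ, E × B → ContinuousMultilinearMap 𝕜 (fun _ : Fin l => E × B) B}

theorem HasLeftSeries.tendsto_partialTwo (h : HasLeftSeries 𝕜 k Ω f D) (hk : 1 ≤ k) {z : E × B}
    (hz : z ∈ Ω) : Tendsto (partialTwo D) (𝓝 z) (𝓝 (partialTwo D z)) := by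
  have h1 : PiTendsto 𝕜 (𝓝 z) (fun y => ⇑((D 1 y).compContinuousLinearMap
      fun _ => ContinuousLinearMap.inr 𝕜 E B)) ((D 1 z).compContinuousLinearMap
      fun _ => ContinuousLinearMap.inr 𝕜 E B) := by
    obtain ⟨U, hU, h⟩ := piTendsto_iff_norm.1 (h.piTendsto 1 (by simpa using hk) z hz)
    rw [piTendsto_iff_norm]
    refine ⟨ContinuousLinearMap.inr 𝕜 E B ⁻¹' U,
      (ContinuousLinearMap.inr 𝕜 E B).continuous.continuousAt.preimage_mem_nhds
        (by rw [map_zero]; exact hU),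
      fun ε hε => (h ε hε).mono fun y hy u hu => hy _ hu⟩
  exact ((continuousMultilinearCurryFin1 𝕜 B B).continuous.tendsto _).comp h1.tendsto

theorem HasLeftSeries.hasPartialTwo [IsTopologicalAddGroup E] [ContinuousSMul 𝕜 E]
    (h : HasLeftSeries 𝕜 k Ω f D) (hΩ : IsOpen Ω) (hk : 1 ≤ k) {x : E} {y : B}
    (hz : (x, y) ∈ Ω) : HasPartialTwo 𝕜 f x y (partialTwo D (x, y)) := by
  intro v
  rw [partialTwo_apply]
  refine (h.dirDeriv_zero hΩ hk hz (0, v)).congr fun t => ?_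
  simp

theorem HasLeftSeries.partialTwoBijective_iff [IsTopologicalAddGroup E] [ContinuousSMul 𝕜 E]
    (h : HasLeftSeries 𝕜 k Ω f D) (hΩ : IsOpen Ω) (hk : 1 ≤ k) {x : E} {y : B}
    (hz : (x, y) ∈ Ω) :
    PartialTwoBijective 𝕜 f x y ↔ Function.Bijective (partialTwo D (x, y)) := by
  have h1 := h.hasPartialTwo hΩ hk hz
  refine ⟨fun ⟨ℓ, hℓ, hb⟩ => ?_, fun hb => ⟨_, h1, hb⟩⟩
  have : ℓ = partialTwo D (x, y) := by
    ext v
    exact tendsto_nhds_unique (hℓ v) (h1 v)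
  rwa [← this]

theorem ContinuousLinearMap.isInvertible_of_bijective [CompleteSpace B] {A : B →L[𝕜] B}
    (hA : Function.Bijective A) : A.IsInvertible :=
  ⟨ContinuousLinearEquiv.ofBijective A (LinearMap.ker_eq_bot.2 hA.1)
    (LinearMap.range_eq_top.2 hA.2), ContinuousLinearEquiv.coe_ofBijective A _ _⟩

end PartialTwo

theorem ContinuousMultilinearMap.map_add_fin_one {𝕜 Y Z : Type*} [Semiring 𝕜] [AddCommMonoid Y]
    [Module 𝕜 Y] [TopologicalSpace Y] [AddCommMonoid Z] [Module 𝕜 Z] [TopologicalSpace Z]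
    (Φ : ContinuousMultilinearMap 𝕜 (fun _ : Fin 1 => Y) Z) (a b : Fin 1 → Y) :
    Φ (a + b) = Φ a + Φ b := by
  have h := Φ.map_update_add a 0 (a 0) (b 0)
  have e : ∀ u : Fin 1 → Y, Function.update a 0 (u 0) = u := fun u => by
    ext1 i
    rw [Subsingleton.elim i 0, Function.update_self]
  rwa [e a, e b, ← Pi.add_apply a b, e (a + b)] at h

/-! ### Regularity of continuous implicit functions -/

section Regularity

variable {𝕜 : Type} [RCLike 𝕜] {E : Type*} [AddCommGroup E] [Module 𝕜 E] [TopologicalSpace E]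
  [IsTopologicalAddGroup E] [ContinuousSMul 𝕜 E]
  {B : Type*} [NormedAddCommGroup B] [NormedSpace 𝕜 B] [CompleteSpace B]
  {k : ℕ∞} {Ω : Set (E × B)} {f : E × B → B}
  {D : ∀ l : ℕ, E × B → ContinuousMultilinearMap 𝕜 (fun _ : Fin l => E × B) B}
  {W : Set E} {g : E → B}
  {S : Type} [NormedAddCommGroup S] [NormedSpace 𝕜 S]

theorem HasLeftSeries.slice (h : HasLeftSeries 𝕜 k Ω f D) (hΩ : IsOpen Ω) (x : E) (L : S →L[𝕜] E) :
    HasFTaylorSeriesUpToOn k (fun z : S × B => f (x + L z.1, z.2))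
      (fun z l => (D l (x + L z.1, z.2)).compContinuousLinearMap
        (fun _ => L.prodMap (ContinuousLinearMap.id 𝕜 B)))
      ((fun z : S × B => (x + L z.1, z.2)) ⁻¹' Ω) := by
  have hO : IsOpen ((fun z : S × B => (x + L z.1, z.2)) ⁻¹' Ω) :=
    hΩ.preimage (by fun_prop)
  have h1 := h.comp_affine (x, (0 : B)) (L.prodMap (ContinuousLinearMap.id 𝕜 B))
  have e : (fun z : S × B => (x, (0 : B)) + (L.prodMap (ContinuousLinearMap.id 𝕜 B)) z) =
      fun z : S × B => (x + L z.1, z.2) := by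
    ext z <;> simp
  have e' : ∀ z : S × B, (x, (0 : B)) + (L.prodMap (ContinuousLinearMap.id 𝕜 B)) z =
      (x + L z.1, z.2) := fun z => congrFun e z
  simp only [e'] at h1
  exact h1.hasFTaylorSeriesUpToOn hO

variable [CompleteSpace S]

/-- On a slice the problem lives in Banach spaces. By continuity the graph of `g` stays in the
region where the classical implicit function is the only solution, so `g` agrees with it locally. -/
theorem HasLeftSeries.contDiffAt_implicit_slice (h : HasLeftSeries 𝕜 k Ω f D) (hΩ : IsOpen Ω)
    (hW : IsOpen W) (hg : ContinuousOn g W) (hgΩ : ∀ x ∈ W, (x, g x) ∈ Ω)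
    (hfg : ∀ x ∈ W, f (x, g x) = 0)
    (hbij : ∀ x ∈ W, Function.Bijective (partialTwo D (x, g x)))
    {n : ℕ} (hn : n ≠ 0) (hnk : (n : ℕ∞) ≤ k) {x : E} (L : S →L[𝕜] E) {s : S}
    (hs : x + L s ∈ W) :
    ContDiffAt 𝕜 n (fun s => g (x + L s)) s := by
  set φ : S × B → B := fun z => f (x + L z.1, z.2) with hφ
  have hφT := (h.slice hΩ x L).of_le (m := n) (by exact_mod_cast hnk)
  set O : Set (S × B) := (fun z : S × B => (x + L z.1, z.2)) ⁻¹' Ω with hOdef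
  have hO : IsOpen O := hΩ.preimage (by fun_prop)
  have hu : (s, g (x + L s)) ∈ O := hgΩ _ hs
  have hcd : ContDiffAt 𝕜 n φ (s, g (x + L s)) :=
    (HasFTaylorSeriesUpToOn.contDiffOn (n := n) hφT).contDiffAt (hO.mem_nhds hu)
  have hn' : ((n : ℕ) : WithTop ℕ∞) ≠ 0 := by exact_mod_cast hn
  have hinv : (fderiv 𝕜 φ (s, g (x + L s)) ∘L .inr 𝕜 S B).IsInvertible := by
    apply ContinuousLinearMap.isInvertible_of_bijective
    convert hbij _ hs
    rw [(hφT.hasFDerivAt hn' (hO.mem_nhds hu)).fderiv]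
    ext v
    simp [partialTwo_apply]
  have hfu : φ (s, g (x + L s)) = 0 := hfg _ hs
  have hev := hcd.eventually_apply_eq_iff_implicitFunction hn' hinv
  rw [hfu] at hev
  have hLW : ∀ᶠ t in 𝓝 s, x + L t ∈ W :=
    (by fun_prop : ContinuousAt (fun t => x + L t) s) (hW.mem_nhds hs)
  have hcont : ContinuousAt (fun t => (t, g (x + L t))) s :=
    continuousAt_id.prodMk (ContinuousAt.comp (g := g) (f := fun t => x + L t)
      (hg.continuousAt (hW.mem_nhds hs)) (by fun_prop))
  refine (hcd.contDiffAt_implicitFunction hn' hinv).congr_of_eventuallyEq ?_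
  filter_upwards [hLW, hcont.eventually hev] with t ht ht'
  exact (ht'.1 (hfg _ ht)).symm

/-- This is the Faà di Bruno formula for the zero function `s ↦ f (x + L s, g (x + L s))`. -/
theorem HasLeftSeries.sum_implicit_slice_eq_zero (h : HasLeftSeries 𝕜 k Ω f D) (hΩ : IsOpen Ω)
    (hW : IsOpen W) (hg : ContinuousOn g W) (hgΩ : ∀ x ∈ W, (x, g x) ∈ Ω)
    (hfg : ∀ x ∈ W, f (x, g x) = 0)
    (hbij : ∀ x ∈ W, Function.Bijective (partialTwo D (x, g x)))
    {n : ℕ} (hn : n ≠ 0) (hnk : (n : ℕ∞) ≤ k) {x : E} (hx : x ∈ W) (L : S →L[𝕜] E)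
    (v : Fin n → S) :
    ∑ c : OrderedFinpartition n, D c.length (x, g x) (fun i =>
      (idSeries 𝕜 (0 : E) (c.partSize i) (fun j => L ((v ∘ c.emb i) j)),
        iteratedFDeriv 𝕜 (c.partSize i) (fun s => g (x + L s)) 0 (v ∘ c.emb i))) = 0 := by
  set O : Set S := (fun s => x + L s) ⁻¹' W with hOdef
  have hO : IsOpen O := hW.preimage (by fun_prop)
  have h0 : (0 : S) ∈ O := by simpa [hOdef] using hx
  have hγ : ContDiffOn 𝕜 n (fun s => g (x + L s)) O := fun s hs =>
    (h.contDiffAt_implicit_slice hΩ hW hg hgΩ hfg hbij hn hnk L hs).contDiffWithinAt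
  have hp := (hasFTaylorSeriesUpToOn_id (𝕜 := 𝕜) n hO).prodMk
    (hγ.ftaylorSeriesWithin hO.uniqueDiffOn)
  have hφT := (h.slice hΩ x L).of_le (m := n) (by exact_mod_cast hnk)
  have hcomp := (hφT.comp hp (fun s hs => hgΩ _ hs)).congr (f₁ := fun _ => (0 : B))
    (fun s hs => (hfg _ hs).symm)
  have key := hcomp.eq_iteratedFDerivWithin_of_uniqueDiffOn (m := n) le_rfl hO.uniqueDiffOn h0
  have hzero : iteratedFDerivWithin 𝕜 n (fun _ : S => (0 : B)) O 0 = 0 := by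
    rw [iteratedFDerivWithin_of_isOpen n hO h0]
    simp
  rw [hzero] at key
  have key' := congrArg (fun Φ => Φ v) key
  simp only [FormalMultilinearSeries.taylorComp] at key'
  rw [sum_apply] at key'
  refine Eq.trans (Finset.sum_congr rfl fun c _ => ?_) key'
  change _ = D c.length (x + L 0, g (x + L 0)) (fun i =>
    (L (idSeries 𝕜 (0 : S) (c.partSize i) (v ∘ c.emb i)),
      iteratedFDerivWithin 𝕜 (c.partSize i) (fun s => g (x + L s)) O 0 (v ∘ c.emb i)))
  simp only [map_zero, add_zero, map_idSeries,
    iteratedFDerivWithin_of_isOpen _ hO h0]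

/-- Solving the Faà di Bruno identity for its top-order term defines `G` recursively. The formula
does not mention slices, so one multilinear map on `E` serves all of them, and it inherits Keller
convergence from its constituents. -/
theorem HasLeftSeries.exists_implicit_differential (h : HasLeftSeries 𝕜 k Ω f D) (hΩ : IsOpen Ω)
    (hk : 1 ≤ k)
    (hW : IsOpen W) (hg : ContinuousOn g W) (hgΩ : ∀ x ∈ W, (x, g x) ∈ Ω)
    (hfg : ∀ x ∈ W, f (x, g x) = 0)
    (hbij : ∀ x ∈ W, Function.Bijective (partialTwo D (x, g x))) (n : ℕ) :
    ∃ G : E → ContinuousMultilinearMap 𝕜 (fun _ : Fin n => E) B, (n : ℕ∞) ≤ k →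
      (∀ x ∈ W, PiTendsto 𝕜 (𝓝 x) (fun y => ⇑(G y)) (G x)) ∧
      ∀ x ∈ W, ∀ (m : ℕ) (L : (Fin m → 𝕜) →L[𝕜] E) (v : Fin n → Fin m → 𝕜),
        iteratedFDeriv 𝕜 n (fun s => g (x + L s)) 0 v = G x (fun i => L (v i)) := by
  induction n using Nat.strong_induction_on with
  | _ n ih =>
  rcases Nat.eq_zero_or_pos n with rfl | hn
  · refine ⟨fun x => ContinuousMultilinearMap.constOfIsEmpty 𝕜 _ (g x), fun _ => ⟨?_, ?_⟩⟩
    · intro x hx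
      rw [piTendsto_iff_norm]
      refine ⟨Set.univ, univ_mem, fun ε hε => ?_⟩
      filter_upwards [hg.continuousAt (hW.mem_nhds hx) (Metric.closedBall_mem_nhds _ hε)]
        with y hy u hu
      exact mem_closedBall_iff_norm.1 hy
    · intro x hx m L v
      simp
  choose! G hG using ih
  -- These are the differentials of `x ↦ (x, g x)` below order `n`, with the unknown one of order
  -- `n` replaced by zero. Parts are nonempty, so the order-zero entry is never used.
  set P : E → ∀ j, ContinuousMultilinearMap 𝕜 (fun _ : Fin j => E) (E × B) := fun x j =>
    (idSeries 𝕜 (0 : E) j).prod (if j < n then G j x else 0) with hP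
  set A : E → B →L[𝕜] B := fun x => partialTwo D (x, g x) with hA
  refine ⟨fun x => (-(A x).inverse).compContinuousMultilinearMap
    (∑ c : OrderedFinpartition n, c.compAlong (D c.length (x, g x)) (fun i => P x (c.partSize i))),
    fun hnk => ⟨fun x hx => ?_, fun x hx m L v => ?_⟩⟩
  · have hc : ContinuousAt (fun y => (y, g y)) x :=
      continuousAt_id.prodMk (hg.continuousAt (hW.mem_nhds hx))
    obtain ⟨e, he⟩ := ContinuousLinearMap.isInvertible_of_bijective (hbij x hx)
    have hAt : Tendsto (fun y => -(A y).inverse) (𝓝 x) (𝓝 (-(A x).inverse)) := by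
      -- Inversion of operators is continuous at invertible ones.
      have h1 : Tendsto A (𝓝 x) (𝓝 (e : B →L[𝕜] B)) := by
        rw [he]
        exact (h.tendsto_partialTwo hk (hgΩ x hx)).comp hc
      have h2 := (contDiffAt_map_inverse (𝕜 := 𝕜) (n := 0) e).continuousAt.tendsto.comp h1
      have h3 : (A x).inverse = (e : B →L[𝕜] B).inverse := by rw [he]
      rw [h3]
      exact h2.neg
    have hsum : PiTendsto 𝕜 (𝓝 x)
        (fun y u => ∑ c : OrderedFinpartition n,
          c.compAlong (D c.length (y, g y)) (fun i => P y (c.partSize i)) u)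
        (fun u => ∑ c : OrderedFinpartition n,
          c.compAlong (D c.length (x, g x)) (fun i => P x (c.partSize i)) u) := by
      refine PiTendsto.sum fun c => PiTendsto.compAlong c ?_ fun i => ?_
      · refine (h.piTendsto c.length ?_ _ (hgΩ x hx)).comp_tendsto hc
        exact le_trans (by exact_mod_cast c.length_le) hnk
      · by_cases hi : c.partSize i < n
        · have := (hG _ hi (le_trans (by exact_mod_cast hi.le) hnk)).1 x hx
          simp only [hP, hi, if_true]
          exact PiTendsto.const_prodMk _ this
        · simp only [hP, hi, if_false]
          exact PiTendsto.const _
    have e₀ : (fun u => ∑ c : OrderedFinpartition n,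
          c.compAlong (D c.length (x, g x)) (fun i => P x (c.partSize i)) u) =
        ⇑(∑ c : OrderedFinpartition n,
          c.compAlong (D c.length (x, g x)) (fun i => P x (c.partSize i))) := by
      ext u
      rw [sum_apply]
    rw [e₀] at hsum
    refine (PiTendsto.clm_apply hAt hsum).congr fun y u => ?_
    simp [sum_apply]
  · have key := h.sum_implicit_slice_eq_zero hΩ hW hg hgΩ hfg hbij hn.ne' hnk hx L v
    have h1 := OrderedFinpartition.sum_eq_sum_add hn (fun l u => D l (x, g x) u)
      (fun a b => (D 1 (x, g x)).map_add_fin_one a b)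
      (fun j u => (idSeries 𝕜 (0 : E) j (fun i => L (u i)),
        iteratedFDeriv 𝕜 j (fun s => g (x + L s)) 0 u))
      (fun j u => P x j (fun i => L (u i))) v
      ((0 : E), iteratedFDeriv 𝕜 n (fun s => g (x + L s)) 0 v)
      (fun j hj hjn u => by
        have := (hG j hjn (le_trans (by exact_mod_cast hjn.le) hnk)).2 x hx m L u
        simp [hP, hjn, this])
      (by simp [hP])
    rw [h1, ← partialTwo_apply] at key
    obtain ⟨e, he⟩ := ContinuousLinearMap.isInvertible_of_bijective (hbij x hx)
    have h3 : A x = e := he.symm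
    have h4 : e (iteratedFDeriv 𝕜 n (fun s => g (x + L s)) 0 v) = partialTwo D (x, g x)
      (iteratedFDeriv 𝕜 n (fun s => g (x + L s)) 0 v) := by rw [← he]; rfl
    rw [← h4, add_comm, add_eq_zero_iff_eq_neg] at key
    have h5 := (e.eq_symm_apply (y := iteratedFDeriv 𝕜 n (fun s => g (x + L s)) 0 v)).2 key
    rw [h5]
    simp only [h3, ContinuousLinearMap.inverse_equiv, map_neg,
      ContinuousLinearMap.compContinuousMultilinearMap_coe, Function.comp_apply,
      sum_apply, neg_apply]
    rfl

/-- Each derivative `dirDeriv` involves only finitely many directions, so it can be computed on the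
slice they span. -/
theorem HasLeftSeries.exists_hasLeftSeries_implicit (h : HasLeftSeries 𝕜 k Ω f D) (hΩ : IsOpen Ω)
    (hk : 1 ≤ k)
    (hW : IsOpen W) (hg : ContinuousOn g W) (hgΩ : ∀ x ∈ W, (x, g x) ∈ Ω)
    (hfg : ∀ x ∈ W, f (x, g x) = 0)
    (hbij : ∀ x ∈ W, Function.Bijective (partialTwo D (x, g x))) :
    ∃ G, HasLeftSeries 𝕜 k W g G := by
  choose G hG using h.exists_implicit_differential hΩ hk hW hg hgΩ hfg hbij
  refine ⟨G, fun x hx u => ?_, fun l hl x hx u v => ?_, fun l hl x hx => (hG l hl).1 x hx⟩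
  · have := (hG 0 (by simp)).2 x hx 0 0 (fun i => i.elim0)
    rw [iteratedFDeriv_zero_apply] at this
    simp only [zero_apply, add_zero] at this
    rw [this]
    congr 1
    ext i
    exact i.elim0
  · have hl' : ((l + 1 : ℕ) : ℕ∞) ≤ k := by exact_mod_cast Order.add_one_le_of_lt hl
    -- The slice sends the standard basis to `v, u₁, …, uₗ`; moving by `t • v` in `E` is moving by
    -- `t • b 0` in the slice.
    set b : Fin (l + 1) → Fin (l + 1) → 𝕜 := fun i => Pi.single i 1 with hb
    set L : (Fin (l + 1) → 𝕜) →L[𝕜] E :=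
      (Fintype.linearCombination 𝕜 (Fin.cons v u : Fin (l + 1) → E)).toContinuousLinearMap with hL
    have hLb : ∀ i, L (b i) = (Fin.cons v u : Fin (l + 1) → E) i := fun i => by
      simp [hL, hb, Fintype.linearCombination_apply_single]
    have hcd : ContDiffAt 𝕜 (l + 1 : ℕ) (fun s => g (x + L s)) 0 :=
      h.contDiffAt_implicit_slice hΩ hW hg hgΩ hfg hbij l.succ_ne_zero hl' L (by simpa using hx)
    have hdiff : DifferentiableAt 𝕜 (iteratedFDeriv 𝕜 l (fun s => g (x + L s))) 0 :=
      hcd.differentiableAt_iteratedFDeriv (by exact_mod_cast l.lt_succ_self)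
    have hder : HasFDerivAt (iteratedFDeriv 𝕜 l (fun s => g (x + L s)))
        (fderiv 𝕜 (iteratedFDeriv 𝕜 l (fun s => g (x + L s))) 0) ((0 : 𝕜) • b 0) := by
      rw [zero_smul]; exact hdiff.hasFDerivAt
    have hline : HasDerivAt (fun t : 𝕜 => t • b 0) (b 0) 0 := by
      simpa using (hasDerivAt_id' (0 : 𝕜)).smul_const (b 0)
    have h1 := hder.comp_hasDerivAt (0 : 𝕜) hline
    have h2 := ((ContinuousMultilinearMap.apply 𝕜 (fun _ : Fin l => Fin (l + 1) → 𝕜) B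
      (fun i : Fin l => b i.succ)).hasFDerivAt.comp_hasDerivAt (0 : 𝕜) h1).tendsto_slope_zero
    have hval : ∀ y ∈ W, ∀ t : 𝕜, y = x + t • v → G l y u =
        iteratedFDeriv 𝕜 l (fun s => g (x + L s)) (t • b 0) (fun i : Fin l => b i.succ) := by
      rintro y hy t rfl
      have h3 := (hG l hl.le).2 _ hy _ L (fun i : Fin l => b i.succ)
      have e : (fun s => g (x + t • v + L s)) = fun s => (fun s => g (x + L s)) (t • b 0 + s) := by
        ext s
        change _ = g (x + L (t • b 0 + s))
        rw [map_add L, map_smul L, hLb, Fin.cons_zero, add_assoc]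
      have e' := iteratedFDeriv_comp_add_left (𝕜 := 𝕜) (f := fun s => g (x + L s)) l (t • b 0) 0
      rw [e, e', add_zero] at h3
      rw [h3]
      simp [hLb]
    have hG1 : G (l + 1) x (Fin.cons v u) =
        (fderiv 𝕜 (iteratedFDeriv 𝕜 l (fun s => g (x + L s))) 0) (b 0)
          (fun i : Fin l => b i.succ) := by
      have h3 := (hG (l + 1) hl').2 x hx _ L b
      rw [iteratedFDeriv_succ_apply_left] at h3
      simp only [hLb] at h3
      exact h3.symm
    rw [hG1]
    refine h2.congr' ?_
    have hev : ∀ᶠ t : 𝕜 in 𝓝[≠] 0, x + t • v ∈ W := by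
      have : ContinuousAt (fun t : 𝕜 => x + t • v) 0 := by fun_prop
      exact (this.mono_left nhdsWithin_le_nhds) (hW.mem_nhds (by simpa using hx))
    filter_upwards [hev] with t ht
    rw [hval _ ht t rfl, hval x hx 0 (by simp)]
    simp

end Regularity

/-! ### Local solutions with a parameter in a topological vector space -/

section LocalExistence

variable {𝕜 : Type} [RCLike 𝕜] {E : Type*} [AddCommGroup E] [Module 𝕜 E] [TopologicalSpace E]
  [IsTopologicalAddGroup E] [ContinuousSMul 𝕜 E]
  {B : Type*} [NormedAddCommGroup B] [NormedSpace 𝕜 B]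
  {k : ℕ∞} {Ω : Set (E × B)} {f : E × B → B}
  {D : ∀ l : ℕ, E × B → ContinuousMultilinearMap 𝕜 (fun _ : Fin l => E × B) B}

theorem HasLeftSeries.hasFDerivAt_snd (h : HasLeftSeries 𝕜 k Ω f D) (hΩ : IsOpen Ω) (hk : 1 ≤ k)
    {x : E} {y : B} (hxy : (x, y) ∈ Ω) :
    HasFDerivAt (fun y => f (x, y)) (partialTwo D (x, y)) y := by
  have h1 := h.comp_affine (x, (0 : B)) (ContinuousLinearMap.inr 𝕜 E B)
  have e : ∀ y : B, (x, (0 : B)) + ContinuousLinearMap.inr 𝕜 E B y = (x, y) := fun y => by simp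
  simp only [e] at h1
  have hO : IsOpen ((fun y => (x, y)) ⁻¹' Ω) := hΩ.preimage (by fun_prop)
  exact (h1.hasFTaylorSeriesUpToOn hO).hasFDerivAt (by exact_mod_cast (by aesop : k ≠ 0))
    (hO.mem_nhds hxy)

/-- The parameter space carries no norm, so the equation is inverted in `y` alone, for each `x`
separately. The estimates are uniform in `x` because the partial differential is continuous in
operator norm jointly in both variables. -/
theorem HasLeftSeries.exists_implicit [CompleteSpace B] (h : HasLeftSeries 𝕜 k Ω f D)
    (hΩ : IsOpen Ω) (hk : 1 ≤ k) {x₀ : E} {y₀ : B} (hz : (x₀, y₀) ∈ Ω) (hf : f (x₀, y₀) = 0)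
    (hb : Function.Bijective (partialTwo D (x₀, y₀))) {O : Set (E × B)} (hO : O ∈ 𝓝 (x₀, y₀)) :
    ∃ (W : Set E) (r : ℝ) (g : E → B), IsOpen W ∧ x₀ ∈ W ∧ 0 < r ∧ ContinuousOn g W ∧
      ∀ x ∈ W, g x ∈ Metric.ball y₀ r ∧ ∀ y ∈ Metric.ball y₀ r,
        (x, y) ∈ O ∧ (x, y) ∈ Ω ∧ (f (x, y) = 0 ↔ y = g x) := by
  let _ : NormedSpace ℝ B := NormedSpace.restrictScalars ℝ 𝕜 B
  obtain ⟨e, he⟩ := ContinuousLinearMap.isInvertible_of_bijective hb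
  -- `M` bounds the inverse, and deviation at most `c = 1 / (2 M)` from `e` leaves half of its
  -- expansion. Hence the factor `2 * M` in `hanti`, which gives both uniqueness and continuity of
  -- the solution.
  set M : NNReal := ‖(e.symm : B →L[𝕜] B)‖₊ + 1 with hM
  have hMpos : 0 < M := by positivity
  set c : NNReal := M⁻¹ / 2 with hc
  have hcpos : 0 < c := by positivity
  have hMc : (M : ℝ) * c = 1 / 2 := by
    rw [hc]; push_cast; field_simp
  have hev : ∀ᶠ z in 𝓝 (x₀, y₀), z ∈ O ∧ z ∈ Ω ∧ ‖partialTwo D z - e‖ ≤ c := by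
    rw [he]
    filter_upwards [hO, hΩ.mem_nhds hz, h.tendsto_partialTwo hk hz
      (Metric.closedBall_mem_nhds _ (show (0 : ℝ) < c from hcpos))] with z h1 h2 h3
    exact ⟨h1, h2, mem_closedBall_iff_norm.1 h3⟩
  rw [nhds_prod_eq] at hev
  obtain ⟨P, hP, Q, hQ, hPQ⟩ := Filter.eventually_prod_iff.1 hev
  obtain ⟨r, hr, hrQ⟩ := Metric.eventually_nhds_iff_ball.1 hQ
  have happ : ∀ x, P x → ApproximatesLinearOn (fun y => f (x, y)) (e : B →L[𝕜] B)
      (Metric.ball y₀ r) c := by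
    intro x hx y hy y' hy'
    exact (convex_ball y₀ r).norm_image_sub_le_of_norm_hasFDerivWithin_le'
      (fun z hz => (h.hasFDerivAt_snd hΩ hk (hPQ hx (hrQ z hz)).2.1).hasFDerivWithinAt)
      (fun z hz => (hPQ hx (hrQ z hz)).2.2) hy' hy
  have hanti : ∀ x, P x → ∀ y ∈ Metric.ball y₀ r, ∀ y' ∈ Metric.ball y₀ r,
      ‖y - y'‖ ≤ 2 * M * ‖f (x, y) - f (x, y')‖ := by
    intro x hx y hy y' hy'
    have h1 := happ x hx y hy y' hy'
    have h2 : ‖y - y'‖ ≤ M * ‖e (y - y')‖ := by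
      have h3 := (e.symm : B →L[𝕜] B).le_opNorm (e (y - y'))
      simp only [ContinuousLinearEquiv.coe_coe, ContinuousLinearEquiv.symm_apply_apply] at h3
      refine h3.trans ?_
      gcongr
      rw [hM]; push_cast
      linarith
    have h4 : ‖e (y - y')‖ ≤ ‖f (x, y) - f (x, y')‖ + c * ‖y - y'‖ := by
      have h5 := norm_sub_le (f (x, y) - f (x, y')) (f (x, y) - f (x, y') - e (y - y'))
      rw [sub_sub_cancel] at h5
      exact h5.trans (by gcongr; exact h1)
    have h6 : ‖y - y'‖ ≤ M * ‖f (x, y) - f (x, y')‖ + (M * c) * ‖y - y'‖ := by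
      refine h2.trans ((mul_le_mul_of_nonneg_left h4 M.coe_nonneg).trans_eq (by ring))
    rw [hMc] at h6
    linarith
  -- The image of the closed ball of radius `r / 2` contains the ball of radius `(M⁻¹ - c) * (r / 2)
  -- = c * (r / 2)` about `f (x, y₀)`, and so contains zero.
  have hsmall : ∀ᶠ x in 𝓝 x₀, ‖f (x, y₀)‖ ≤ c * (r / 2) := by
    have h1 : ContinuousAt (fun x => f (x, y₀)) x₀ :=
      ContinuousAt.comp (f := fun x => (x, y₀)) (h.continuousAt hΩ hz) (by fun_prop)
    have h2 := h1 (Metric.closedBall_mem_nhds _ (show (0 : ℝ) < c * (r / 2) by positivity))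
    filter_upwards [h2] with x hx
    simpa [hf] using hx
  set right : (e : B →L[𝕜] B).NonlinearRightInverse :=
    { toFun := e.symm
      nnnorm := M
      bound' := fun y => ((e.symm : B →L[𝕜] B).le_opNorm y).trans (by
        gcongr
        rw [hM]; push_cast
        linarith)
      right_inv' := e.apply_symm_apply } with hright
  have hex : ∀ x, P x ∧ ‖f (x, y₀)‖ ≤ c * (r / 2) → ∃ y ∈ Metric.ball y₀ r, f (x, y) = 0 := by
    rintro x ⟨hx, hx'⟩
    have h1 := (happ x hx).surjOn_closedBall_of_nonlinearRightInverse right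
      (b := y₀) (ε := r / 2) (by positivity) (Metric.closedBall_subset_ball (by linarith))
    have h2 : ((right.nnnorm : ℝ)⁻¹ - c) = c := by
      rw [hright, hc]; push_cast; ring
    rw [h2] at h1
    obtain ⟨y, hy, hy'⟩ := h1 (show (0 : B) ∈ _ by simpa using hx')
    exact ⟨y, Metric.closedBall_subset_ball (by linarith) hy, hy'⟩
  choose! g hg hfg using hex
  obtain ⟨W, hWs, hW, hxW⟩ := mem_nhds_iff.1 (Filter.inter_mem hP hsmall)
  refine ⟨W, r, g, hW, hxW, hr, ?_, fun x hx => ⟨hg x (hWs hx), fun y hy => ?_⟩⟩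
  · intro x hx
    refine ContinuousAt.continuousWithinAt ?_
    have hxΩ : (x, g x) ∈ Ω := (hPQ (hWs hx).1 (hrQ _ (hg x (hWs hx)))).2.1
    have h1 : ContinuousAt (fun x' => f (x', g x)) x :=
      ContinuousAt.comp (f := fun x' => (x', g x)) (h.continuousAt hΩ hxΩ) (by fun_prop)
    have h2 : Tendsto (fun x' => 2 * M * ‖f (x', g x)‖) (𝓝 x) (𝓝 0) := by
      have := (h1.norm.const_mul (2 * (M : ℝ))).tendsto
      rwa [hfg x (hWs hx), norm_zero, mul_zero] at this
    rw [ContinuousAt, tendsto_iff_norm_sub_tendsto_zero]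
    refine squeeze_zero' (Eventually.of_forall fun _ => norm_nonneg _) ?_ h2
    filter_upwards [hW.mem_nhds hx] with x' hx'
    have := hanti x' (hWs hx').1 _ (hg x' (hWs hx')) _ (hg x (hWs hx))
    rwa [hfg x' (hWs hx'), zero_sub, norm_neg] at this
  · have hq := hPQ (hWs hx).1 (hrQ _ hy)
    refine ⟨hq.1, hq.2.1, fun h0 => ?_, fun h0 => h0 ▸ hfg x (hWs hx)⟩
    have := hanti x (hWs hx).1 _ hy _ (hg x (hWs hx))
    rw [h0, hfg x (hWs hx), sub_self, norm_zero, mul_zero] at this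
    exact sub_eq_zero.1 (norm_le_zero_iff.1 this)

end LocalExistence

/-- Directional derivatives commute with `T` and are unique in a Hausdorff space. -/
theorem HasLeftSeries.map_eq {𝕜 : Type} [RCLike 𝕜]
    {E : Type*} [AddCommGroup E] [Module 𝕜 E] [TopologicalSpace E] [IsTopologicalAddGroup E]
    [ContinuousSMul 𝕜 E]
    {F : Type*} [AddCommGroup F] [Module 𝕜 F] [TopologicalSpace F]
    {F' : Type*} [AddCommGroup F'] [Module 𝕜 F'] [TopologicalSpace F'] [T2Space F']
    {k : ℕ∞} {Ω : Set E} {f : E → F} {f' : E → F'}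
    {D : ∀ l : ℕ, E → ContinuousMultilinearMap 𝕜 (fun _ : Fin l => E) F}
    {D' : ∀ l : ℕ, E → ContinuousMultilinearMap 𝕜 (fun _ : Fin l => E) F'}
    (h : HasLeftSeries 𝕜 k Ω f D) (h' : HasLeftSeries 𝕜 k Ω f' D') (hΩ : IsOpen Ω)
    (T : F →L[𝕜] F') (hT : ∀ x ∈ Ω, T (f x) = f' x) (l : ℕ) (hl : (l : ℕ∞) ≤ k) {x : E}
    (hx : x ∈ Ω) (u : Fin l → E) : T (D l x u) = D' l x u := by
  induction l generalizing x with
  | zero => rw [h.zero_eq x hx, h'.zero_eq x hx, hT x hx]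
  | succ l ih =>
    have hl' : (l : ℕ∞) < k := lt_of_lt_of_le (by exact_mod_cast l.lt_succ_self) hl
    have h1 := h.dirDeriv l hl' x hx (Fin.tail u) (u 0)
    have h2 := h'.dirDeriv l hl' x hx (Fin.tail u) (u 0)
    rw [Fin.cons_self_tail] at h1 h2
    have h3 := (T.continuous.tendsto _).comp h1
    refine tendsto_nhds_unique (h3.congr' ?_) h2
    have hev : ∀ᶠ t : 𝕜 in 𝓝[≠] 0, x + t • u 0 ∈ Ω := by
      have : ContinuousAt (fun t : 𝕜 => x + t • u 0) 0 := by fun_prop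
      exact (this.mono_left nhdsWithin_le_nhds) (hΩ.mem_nhds (by simpa using hx))
    filter_upwards [hev] with t ht
    simp only [Function.comp_apply, map_smul, map_sub]
    rw [ih hl'.le hx, ih hl'.le ht]

/-! ### Projective limits: points, topology and differentials -/

section ProjLimit

variable {𝕜 : Type} [RCLike 𝕜]
  {I : Type uI} [Preorder I]
  {B : I → Type uB} [∀ i, NormedAddCommGroup (B i)] [∀ i, NormedSpace 𝕜 (B i)]
  {ρ : ∀ i j : I, i ≤ j → (B j →L[𝕜] B i)}
  {F : Type uF} [AddCommGroup F] [Module 𝕜 F] [TopologicalSpace F]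
  {p : ∀ i, F →L[𝕜] B i}

namespace IsLCSProjLimit

/-- Otherwise the inclusion of the line through `x` and the zero map would be two factorizations of
the zero cone. -/
theorem eq_zero [IsTopologicalAddGroup F] [ContinuousSMul 𝕜 F] [PolynormableSpace 𝕜 F] [T2Space F]
    (h : IsLCSProjLimit 𝕜 ρ p) {x : F} (hx : ∀ i, p i x = 0) : x = 0 := by
  obtain ⟨ℓ, -, hℓ⟩ := h.2 (Submodule.span 𝕜 {x}) (fun i => 0) (fun i j hij y => by simp)
  have h1 := hℓ 0 (fun i y => by simp)
  have h2 := hℓ (Submodule.span 𝕜 {x}).subtypeL (fun i y => by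
    obtain ⟨a, ha⟩ := Submodule.mem_span_singleton.1 y.2
    simp [← ha, hx])
  have h3 := DFunLike.congr_fun (h2.trans h1.symm) ⟨x, Submodule.mem_span_singleton_self x⟩
  simpa using h3

/-- A thread is a cone from the scalar field, lifted here to the universe of `F`; its factorization
is evaluated at `1`. -/
theorem exists_of_thread (h : IsLCSProjLimit 𝕜 ρ p) (y : ∀ i, B i)
    (hy : ∀ i j (hij : i ≤ j), y i = ρ i j hij (y j)) : ∃ x : F, ∀ i, p i x = y i := by
  obtain ⟨ℓ, hℓ, -⟩ := h.2 (ULift.{uF} 𝕜) (fun i =>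
    { toFun := fun a => a.down • y i
      map_add' := fun a b => by simp [add_smul]
      map_smul' := fun a b => by simp [mul_smul]
      cont := (continuous_uliftDown).smul continuous_const })
    (fun i j hij a => by
      change a.down • y i = ρ i j hij (a.down • y j)
      rw [map_smul, hy i j hij])
  refine ⟨ℓ ⟨1⟩, fun i => (hℓ i _).trans ?_⟩
  exact one_smul _ _

theorem continuous_linearMap [IsTopologicalAddGroup F] [ContinuousSMul 𝕜 F] [PolynormableSpace 𝕜 F]
    [T2Space F] (h : IsLCSProjLimit 𝕜 ρ p) {G : Type uF} [AddCommGroup G] [Module 𝕜 G]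
    [TopologicalSpace G] [IsTopologicalAddGroup G] [ContinuousSMul 𝕜 G] [PolynormableSpace 𝕜 G]
    [T2Space G] (e : G →ₗ[𝕜] F) (he : ∀ i, Continuous fun x => p i (e x)) : Continuous e := by
  obtain ⟨ℓ, hℓ, -⟩ := h.2 G (fun i => ⟨(p i).toLinearMap ∘ₗ e, he i⟩)
    (fun i j hij y => h.1 i j hij (e y))
  have hid : ⇑ℓ = e := funext fun y => by
    refine sub_eq_zero.1 (h.eq_zero fun i => ?_)
    rw [map_sub, sub_eq_zero]
    exact hℓ i y
  exact hid ▸ ℓ.continuous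

/-- The coarsest topology making the given continuous linear maps continuous. -/
abbrev initialTopology (p : ∀ i, F →L[𝕜] B i) : TopologicalSpace F :=
  ⨅ i, TopologicalSpace.induced (p i) inferInstance

/-- With the initial topology `F` is again a Hausdorff locally convex cone. The universal property
makes the identity from it to `F` continuous, so the given topology is no finer. -/
theorem nhds_eq [IsTopologicalAddGroup F] [ContinuousSMul 𝕜 F] [PolynormableSpace 𝕜 F] [T2Space F]
    (h : IsLCSProjLimit 𝕜 ρ p) (x : F) : 𝓝 x = ⨅ i, comap (p i) (𝓝 (p i x)) := by
  refine le_antisymm (le_iInf fun i => ((p i).continuous.tendsto x).le_comap) ?_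
  have hp : ∀ i, @Continuous F (B i) (initialTopology p) _ (p i) := fun i =>
    continuous_iff_le_induced.2 (iInf_le _ i)
  have hnhds : @nhds F (initialTopology p) x = ⨅ i, comap (p i) (𝓝 (p i x)) := by
    rw [nhds_iInf]
    exact iInf_congr fun i => nhds_induced _ _
  have i1 : @IsTopologicalAddGroup F (initialTopology p) _ :=
    topologicalAddGroup_iInf fun i => topologicalAddGroup_induced (p i)
  have i2 : @ContinuousSMul 𝕜 F _ _ (initialTopology p) :=
    continuousSMul_iInf fun i => continuousSMul_induced (p i).toLinearMap
  have i3 : @PolynormableSpace 𝕜 F _ _ _ (initialTopology p) :=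
    PolynormableSpace.iInf fun i => PolynormableSpace.induced (p i).toLinearMap
  have i4 : @T2Space F (initialTopology p) := by
    refine @T2Space.of_injective_continuous F (∀ i, B i) (initialTopology p) _ _
      (fun x i => p i x) ?_ ?_
    · intro x y hxy
      refine sub_eq_zero.1 (h.eq_zero fun i => ?_)
      rw [map_sub, sub_eq_zero]
      exact congrFun hxy i
    · exact @continuous_pi F I B (initialTopology p) _ _ hp
  have hcont := @continuous_linearMap 𝕜 _ I _ B _ _ ρ F _ _ _ p _ _ _ _ h F _ _
    (initialTopology p) i1 i2 i3 i4 LinearMap.id hp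
  rw [← hnhds]
  exact @Continuous.tendsto F F (initialTopology p) _ _ hcont x

variable [IsDirectedOrder I] [IsTopologicalAddGroup F] [ContinuousSMul 𝕜 F] [PolynormableSpace 𝕜 F]
  [T2Space F]

theorem nhds_eq_tail (h : IsLCSProjLimit 𝕜 ρ p) (i₀ : I) (x : F) :
    𝓝 x = ⨅ j : {j // i₀ ≤ j}, comap (p j) (𝓝 (p j x)) := by
  rw [h.nhds_eq]
  refine le_antisymm (le_iInf fun j => iInf_le _ j.1) (le_iInf fun i => ?_)
  obtain ⟨j, hij, hj⟩ := exists_ge_ge i i₀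
  refine (iInf_le _ ⟨j, hj⟩).trans ?_
  have e : (p i : F → B i) = ρ i j hij ∘ p j := funext fun y => h.1 i j hij y
  have hc := (ρ i j hij).continuous.tendsto (p j x)
  rw [e, ← comap_comap]
  exact comap_mono hc.le_comap

theorem exists_subset_of_mem_nhds (h : IsLCSProjLimit 𝕜 ρ p) (i₀ : I) {x : F} {W : Set F}
    (hW : W ∈ 𝓝 x) : ∃ j, i₀ ≤ j ∧ ∃ N ∈ 𝓝 (p j x), p j ⁻¹' N ⊆ W := by
  rw [h.nhds_eq_tail i₀] at hW
  have : Nonempty {j // i₀ ≤ j} := ⟨⟨i₀, le_rfl⟩⟩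
  rw [mem_iInf_of_directed] at hW
  · obtain ⟨j, N, hN, hNW⟩ := hW
    exact ⟨j, j.2, N, hN, hNW⟩
  · intro a b
    obtain ⟨c, hac, hbc⟩ := exists_ge_ge a.1 b.1
    have key : ∀ a : {j // i₀ ≤ j}, ∀ hac : a.1 ≤ c,
        comap (p c) (𝓝 (p c x)) ≤ comap (p a) (𝓝 (p a x)) := by
      intro a hac
      have e : (p a : F → B a) = ρ a c hac ∘ p c := funext fun y => h.1 a c hac y
      have hc := (ρ a c hac).continuous.tendsto (p c x)
      rw [e, ← comap_comap]
      exact comap_mono hc.le_comap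
    exact ⟨⟨c, a.2.trans hac⟩, key a hac, key b hbc⟩

theorem tendsto_iff (h : IsLCSProjLimit 𝕜 ρ p) (i₀ : I) {X : Type*} {a : Filter X} {φ : X → F}
    {x : F} : Tendsto φ a (𝓝 x) ↔ ∀ j, i₀ ≤ j → Tendsto (fun t => p j (φ t)) a (𝓝 (p j x)) := by
  rw [h.nhds_eq_tail i₀, tendsto_iInf, Subtype.forall]
  simp only [tendsto_comap_iff]
  rfl

variable {i₀ : I}

theorem injective_of_tail (h : IsLCSProjLimit 𝕜 ρ p)
    (hinj : ∀ j hj, Function.Injective (ρ i₀ j hj)) : Function.Injective (p i₀) := by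
  rw [injective_iff_map_eq_zero]
  refine fun x hx => h.eq_zero fun i => ?_
  obtain ⟨j, hij, hj⟩ := exists_ge_ge i i₀
  rw [h.1 i₀ j hj] at hx
  rw [h.1 i j hij, (map_eq_zero_iff _ (hinj j hj)).1 hx, map_zero]

/-- Injectivity makes the preimages of `b` at the various levels compatible. An index not above `i₀`
receives its coordinate from a common upper bound with `i₀`. -/
theorem exists_of_forall_mem_range (h : IsLCSProjLimit 𝕜 ρ p) (hρ : IsProjSystem 𝕜 ρ)
    (hinj : ∀ j hj, Function.Injective (ρ i₀ j hj)) {b : B i₀}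
    (hb : ∀ j hj, b ∈ Set.range (ρ i₀ j hj)) : ∃ x : F, p i₀ x = b := by
  choose y hy using hb
  choose m hm hm₀ using fun i => exists_ge_ge i i₀
  obtain ⟨x, hx⟩ := h.exists_of_thread (fun i => ρ i (m i) (hm i) (y (m i) (hm₀ i))) (by
    intro i j hij
    obtain ⟨n, hin, hjn⟩ := exists_ge_ge (m i) (m j)
    have key : ∀ i (hin : m i ≤ n), y (m i) (hm₀ i) =
        ρ (m i) n hin (y n ((hm₀ i).trans hin)) := fun i hin => by
      apply hinj _ (hm₀ i)
      rw [hy, hρ.2, hy]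
    rw [key i hin, key j hjn, hρ.2, hρ.2, hρ.2])
  exact ⟨x, (hx i₀).trans (hy _ _)⟩

theorem exists_multilinear (h : IsLCSProjLimit 𝕜 ρ p) (hρ : IsProjSystem 𝕜 ρ)
    (hinj : ∀ j hj, Function.Injective (ρ i₀ j hj)) {E : Type*} [AddCommGroup E] [Module 𝕜 E]
    [TopologicalSpace E] {l : ℕ}
    (Ψ : ∀ j, i₀ ≤ j → ContinuousMultilinearMap 𝕜 (fun _ : Fin l => E) (B j))
    (hΨ : ∀ j hj u, ρ i₀ j hj (Ψ j hj u) = Ψ i₀ le_rfl u) :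
    ∃ Φ : ContinuousMultilinearMap 𝕜 (fun _ : Fin l => E) F, ∀ j hj u, p j (Φ u) = Ψ j hj u := by
  choose φ hφ using fun u => h.exists_of_forall_mem_range hρ hinj (b := Ψ i₀ le_rfl u)
    (fun j hj => ⟨Ψ j hj u, hΨ j hj u⟩)
  have hp := h.injective_of_tail hinj
  have hφj : ∀ j hj u, p j (φ u) = Ψ j hj u := fun j hj u => by
    apply hinj j hj
    rw [hΨ, ← h.1 i₀ j hj, hφ]
  refine ⟨{ toMultilinearMap := MultilinearMap.mk' φ (fun v i x y => hp ?_) (fun v i a x => hp ?_)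
            cont := ?_ }, hφj⟩
  · simp [hφ]
  · simp [hφ]
  · change Continuous φ
    rw [continuous_iff_continuousAt]
    intro u
    refine (h.tendsto_iff i₀).2 fun j hj => ?_
    simp only [hφj j hj]
    exact (Ψ j hj).cont.continuousAt

/-- The levelwise differentials correspond under the transition maps and so come from multilinear
maps into `F`. For Keller's condition a single level suffices, since a zero neighbourhood of `F`
contains the preimage of one at some `j` above `i₀`. -/
theorem exists_hasLeftSeries (h : IsLCSProjLimit 𝕜 ρ p) (hρ : IsProjSystem 𝕜 ρ)
    (hinj : ∀ j hj, Function.Injective (ρ i₀ j hj)) {E : Type*} [AddCommGroup E] [Module 𝕜 E]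
    [TopologicalSpace E] [IsTopologicalAddGroup E] [ContinuousSMul 𝕜 E] {k : ℕ∞} {W : Set E}
    (hW : IsOpen W) {φ : E → F}
    (hφ : ∀ j, i₀ ≤ j → ∃ D, HasLeftSeries 𝕜 k W (fun x => p j (φ x)) D) :
    ∃ D, HasLeftSeries 𝕜 k W φ D := by
  choose D hD using hφ
  have hex : ∀ (l : ℕ) (x : E), ∃ Φ : ContinuousMultilinearMap 𝕜 (fun _ : Fin l => E) F,
      (l : ℕ∞) ≤ k → x ∈ W → ∀ j hj u, p j (Φ u) = D j hj l x u := by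
    intro l x
    by_cases hlx : (l : ℕ∞) ≤ k ∧ x ∈ W
    · obtain ⟨Φ, hΦ⟩ := h.exists_multilinear hρ hinj (fun j hj => D j hj l x) (fun j hj u =>
        (hD j hj).map_eq (hD i₀ le_rfl) hW (ρ i₀ j hj) (fun x _ => (h.1 i₀ j hj (φ x)).symm)
          l hlx.1 hlx.2 u)
      exact ⟨Φ, fun _ _ => hΦ⟩
    · exact ⟨0, fun h1 h2 => (hlx ⟨h1, h2⟩).elim⟩
  choose Φ hΦ using hex
  refine ⟨Φ, fun x hx u => h.injective_of_tail hinj ?_, fun l hl x hx u v => ?_,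
    fun l hl x hx N hN => ?_⟩
  · rw [hΦ 0 x (by simp) hx i₀ le_rfl, (hD i₀ le_rfl).zero_eq x hx]
  · have hl' : ((l + 1 : ℕ) : ℕ∞) ≤ k := by exact_mod_cast Order.add_one_le_of_lt hl
    refine (h.tendsto_iff i₀).2 fun j hj => ?_
    rw [hΦ _ x hl' hx j hj]
    refine ((hD j hj).dirDeriv l hl x hx u v).congr' ?_
    have hev : ∀ᶠ t : 𝕜 in 𝓝[≠] 0, x + t • v ∈ W := by
      have : ContinuousAt (fun t : 𝕜 => x + t • v) 0 := by fun_prop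
      exact (this.mono_left nhdsWithin_le_nhds) (hW.mem_nhds (by simpa using hx))
    filter_upwards [hev] with t ht
    rw [map_smul, map_sub, hΦ l _ hl.le ht j hj, hΦ l _ hl.le hx j hj]
  · obtain ⟨j, hj, N', hN', hNN⟩ := h.exists_subset_of_mem_nhds i₀ hN
    rw [map_zero] at hN'
    obtain ⟨U, hU, hUε⟩ := (hD j hj).piTendsto l hl x hx N' hN'
    refine ⟨U, hU, fun ε hε => ?_⟩
    have hε' : (ε : 𝕜) ≠ 0 := by exact_mod_cast hε.ne'
    filter_upwards [hUε ε hε, hW.mem_nhds hx] with y hy hyW u hu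
    refine ⟨(ε : 𝕜)⁻¹ • (Φ l y u - Φ l x u), hNN ?_, ?_⟩
    · obtain ⟨w, hw, e⟩ := hy u hu
      rw [Set.mem_preimage, map_smul, map_sub, hΦ l _ hl hyW j hj, hΦ l _ hl hx j hj, e,
        smul_smul, inv_mul_cancel₀ hε', one_smul]
      exact hw
    · rw [smul_smul, mul_inv_cancel₀ hε', one_smul]

end IsLCSProjLimit

end ProjLimit

/-! ### Lifting a solution to a higher level by continuation along segments -/

theorem exists_continuousOn_lift {𝕜 : Type} [RCLike 𝕜]
    {E : Type*} [AddCommGroup E] [Module 𝕜 E] [TopologicalSpace E]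
    [IsTopologicalAddGroup E] [ContinuousSMul 𝕜 E]
    {B₀ : Type*} [NormedAddCommGroup B₀] [NormedSpace 𝕜 B₀]
    {B : Type*} [NormedAddCommGroup B] [NormedSpace 𝕜 B] [CompleteSpace B]
    {T : B →L[𝕜] B₀} (hT : Function.Injective T)
    {Ω₀ : Set (E × B₀)} {f₀ : E × B₀ → B₀} {k : ℕ∞} {Ω : Set (E × B)} {f : E × B → B}
    {D : ∀ l : ℕ, E × B → ContinuousMultilinearMap 𝕜 (fun _ : Fin l => E × B) B}
    (h : HasLeftSeries 𝕜 k Ω f D) (hΩ : IsOpen Ω) (hk : 1 ≤ k)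
    (hdom : ∀ x y, (x, y) ∈ Ω ↔ (x, T y) ∈ Ω₀)
    (hmap : ∀ x y, (x, y) ∈ Ω → T (f (x, y)) = f₀ (x, T y))
    {W : Set E} (hW : IsOpen W) {x₀ : E}
    (hstar : ∀ x ∈ W, ∀ t ∈ Set.Icc (0 : ℝ) 1, x₀ + (t : 𝕜) • (x - x₀) ∈ W)
    {N : Set B₀} (hN : IsOpen N) {g₀ : E → B₀}
    (hg₀N : ∀ x ∈ W, g₀ x ∈ N ∧ ∀ y ∈ N, (x, y) ∈ Ω₀ ∧ (f₀ (x, y) = 0 ↔ y = g₀ x))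
    (hbij : ∀ x ∈ W, ∀ y, T y = g₀ x → Function.Bijective (partialTwo D (x, y)))
    (h₀ : x₀ ∈ W → g₀ x₀ ∈ Set.range T)
    (hseq : ∀ x₁ ∈ W, ∀ y : ℕ → B,
      (∀ n : ℕ, 1 ≤ n → (n : 𝕜)⁻¹ • x₀ + (1 - (n : 𝕜)⁻¹) • x₁ ∈ W ∧
        T (y n) = g₀ ((n : 𝕜)⁻¹ • x₀ + (1 - (n : 𝕜)⁻¹) • x₁)) → g₀ x₁ ∈ Set.range T) :
    ∃ g : E → B, ContinuousOn g W ∧ ∀ x ∈ W, T (g x) = g₀ x := by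
  -- Where `g₀ x` lifts, the implicit function theorem upstairs gives a continuous local solution,
  -- and uniqueness downstairs identifies its image with `g₀`.
  have hlocal : ∀ x ∈ W, ∀ y, T y = g₀ x → ∃ φ : E → B, ContinuousAt φ x ∧ φ x = y ∧
      ∀ᶠ x' in 𝓝 x, T (φ x') = g₀ x' := by
    intro x hx y hy
    have hxy : (x, y) ∈ Ω := by
      rw [hdom, hy]; exact ((hg₀N x hx).2 _ (hg₀N x hx).1).1
    have hzero : f (x, y) = 0 := by
      apply hT
      rw [hmap _ _ hxy, hy, map_zero]
      exact ((hg₀N x hx).2 _ (hg₀N x hx).1).2.2 rfl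
    obtain ⟨V, r, φ, hV, hxV, hr, hφ, hφV⟩ :=
      h.exists_implicit hΩ hk hxy hzero (hbij x hx y hy) univ_mem
    have hφx : φ x = y :=
      (((hφV x hxV).2 y (Metric.mem_ball_self hr)).2.2.1 hzero).symm
    have hφc : ContinuousAt φ x := hφ.continuousAt (hV.mem_nhds hxV)
    refine ⟨φ, hφc, hφx, ?_⟩
    have hTφ : ContinuousAt (fun x' => T (φ x')) x := T.continuous.continuousAt.comp hφc
    have hTN : T (φ x) ∈ N := by rw [hφx, hy]; exact (hg₀N x hx).1
    filter_upwards [hV.mem_nhds hxV, hW.mem_nhds hx, hTφ (hN.mem_nhds hTN)] with x' h1 h2 h3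
    obtain ⟨h4, h5⟩ := hφV x' h1
    obtain ⟨-, h6, h7⟩ := h5 _ h4
    refine ((hg₀N x' h2).2 _ h3).2.1 ?_
    rw [← hmap _ _ h6, h7.2 rfl, map_zero]
  have hrange : ∀ x ∈ W, g₀ x ∈ Set.range T := by
    intro x hx
    by_contra hcon
    set γ : ℝ → E := fun t => x₀ + (t : 𝕜) • (x - x₀) with hγ
    have hγc : Continuous γ := by
      have : Continuous (fun t : ℝ => (t : 𝕜)) := RCLike.continuous_ofReal
      fun_prop
    -- The bad parameters on the segment form a closed set by `hlocal`. Its least element `s` is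
    -- positive, since the value at `x₀` lifts, and every earlier parameter is good.
    set C : Set ℝ := {t | t ∈ Set.Icc (0 : ℝ) 1 ∧ g₀ (γ t) ∉ Set.range T} with hC
    have hCc : IsClosed C := by
      rw [← isOpen_compl_iff, isOpen_iff_mem_nhds]
      intro t ht
      by_cases htI : t ∈ Set.Icc (0 : ℝ) 1
      · have h1 : g₀ (γ t) ∈ Set.range T := by
          by_contra h1
          exact ht ⟨htI, h1⟩
        obtain ⟨y, hy⟩ := h1
        obtain ⟨φ, -, -, hφ⟩ := hlocal _ (hstar x hx t htI) y hy
        filter_upwards [hγc.continuousAt hφ] with s hs hsC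
        exact hsC.2 ⟨_, hs⟩
      · filter_upwards [isClosed_Icc.isOpen_compl.mem_nhds htI] with s hs hsC
        exact hs hsC.1
    have hCne : C.Nonempty := ⟨1, by simp, by simpa [hγ] using hcon⟩
    have hCb : BddBelow C := ⟨0, fun t ht => ht.1.1⟩
    obtain ⟨hsI, hs⟩ := hCc.csInf_mem hCne hCb
    set s := sInf C with hs_def
    have hx₀ : x₀ ∈ W := by simpa using hstar x hx 0 (by simp)
    have hspos : 0 < s := by
      refine lt_of_le_of_ne hsI.1 fun h0 => hs ?_
      rw [← h0]
      simpa [hγ] using h₀ hx₀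
    have hlt : ∀ t ∈ Set.Ico 0 s, g₀ (γ t) ∈ Set.range T := by
      intro t ht
      by_contra h1
      exact notMem_of_lt_csInf ht.2 hCb ⟨⟨ht.1, ht.2.le.trans hsI.2⟩, h1⟩
    -- The points in `hseq` for `x₁ = γ s` lie on the segment at parameters `(1 - 1 / n) * s < s`,
    -- where lifts exist; so the value at `s` lifts too, a contradiction.
    have hpt : ∀ n : ℕ, 1 ≤ n → (n : 𝕜)⁻¹ • x₀ + (1 - (n : 𝕜)⁻¹) • γ s =
        γ ((1 - (n : ℝ)⁻¹) * s) := by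
      intro n hn
      simp only [hγ]
      push_cast
      module
    have hmem : ∀ n : ℕ, 1 ≤ n → (1 - (n : ℝ)⁻¹) * s ∈ Set.Ico 0 s := by
      intro n hn
      have hn' : (1 : ℝ) ≤ n := by exact_mod_cast hn
      have h1 : (n : ℝ)⁻¹ ≤ 1 := inv_le_one_of_one_le₀ hn'
      have h2 : (0 : ℝ) < (n : ℝ)⁻¹ := by positivity
      exact ⟨mul_nonneg (by linarith) hspos.le, by nlinarith⟩
    choose! y hy using fun (n : ℕ) (hn : 1 ≤ n) => hlt _ (hmem n hn)
    refine hs (hseq (γ s) (hstar x hx s hsI) y fun n hn => ?_)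
    rw [hpt n hn]
    exact ⟨hstar x hx _ ⟨(hmem n hn).1, (hmem n hn).2.le.trans hsI.2⟩, hy n hn⟩
  choose! g hg using hrange
  refine ⟨g, fun x hx => ?_, hg⟩
  -- As `T` is injective, the chosen lift coincides near `x` with the continuous local one.
  obtain ⟨φ, hφc, hφx, hφ⟩ := hlocal x hx (g x) (hg x hx)
  refine (hφc.congr ?_).continuousWithinAt
  filter_upwards [hφ, hW.mem_nhds hx] with x' h1 h2
  exact hT (h1.trans (hg x' h2).symm)

/-- The interior of a balanced zero neighbourhood is balanced; it is translated to `x₀`. -/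
theorem exists_isOpen_star_subset (𝕜 : Type) [RCLike 𝕜]
    {E : Type*} [AddCommGroup E] [Module 𝕜 E] [TopologicalSpace E]
    [IsTopologicalAddGroup E] [ContinuousSMul 𝕜 E] {x₀ : E} {V : Set E} (hV : V ∈ 𝓝 x₀) :
    ∃ W ⊆ V, IsOpen W ∧ x₀ ∈ W ∧
      ∀ x ∈ W, ∀ t ∈ Set.Icc (0 : ℝ) 1, x₀ + (t : 𝕜) • (x - x₀) ∈ W := by
  have h1 : (fun v => x₀ + v) ⁻¹' V ∈ 𝓝 (0 : E) :=
    (by fun_prop : ContinuousAt (fun v => x₀ + v) 0).preimage_mem_nhds (by simpa using hV)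
  obtain ⟨A, ⟨hA, hAb⟩, hAV⟩ := (nhds_basis_balanced 𝕜 E).mem_iff.1 h1
  have h0 : (0 : E) ∈ interior A := mem_interior_iff_mem_nhds.2 hA
  refine ⟨(fun x => x - x₀) ⁻¹' interior A, fun x hx => ?_,
    isOpen_interior.preimage (by fun_prop), by simpa using h0, fun x hx t ht => ?_⟩
  · have : x₀ + (x - x₀) ∈ V := hAV (interior_subset hx)
    simpa using this
  · have := (hAb.interior h0).smul_mem (a := (t : 𝕜))
      (by rw [RCLike.norm_ofReal, abs_of_nonneg ht.1]; exact ht.2) hx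
    simpa using this

/-! ### The local inverse -/

theorem corollary4p6 {𝕜 : Type} [RCLike 𝕜]
    {E : Type uE} [AddCommGroup E] [Module 𝕜 E] [TopologicalSpace E] [IsTopologicalAddGroup E]
    [ContinuousSMul 𝕜 E] [PolynormableSpace 𝕜 E] [T2Space E]
    (k : ℕ∞) (Ω : Set E) (f : E → E) (z : E × E)
    (hf : BIExtensible.{uE, uI, uB} 𝕜 k Ω f z) :
    ∃ U V : Set E, IsOpen U ∧ IsOpen V ∧ z.1 ∈ V ∧ z.2 ∈ U ∧
      IsLocalKellerDiffeo 𝕜 k Ω f U V := by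
  obtain ⟨x₀, y₀⟩ := z
  obtain ⟨X, hk, hzΩ, hfz, hKel, i₀, W₀, hW₀o, hW₀, hW₀dom, hbij₀, hext⟩ := hf
  simp only [Set.mem_ofPred_eq] at hzΩ hfz
  have := X.complete
  have hlim := X.isLimit
  have hproj := X.isProjSystem
  choose hdomo D hD using fun i => isKeller_iff_left.1 (hKel i)
  have hinj : ∀ j hj, Function.Injective (X.ρ i₀ j hj) := fun j hj => (hext j hj).1
  have hp := hlim.injective_of_tail hinj
  have hpdom : ∀ j, i₀ ≤ j → ∀ x y, y ∈ Ω ↔ (x, X.p j y) ∈ X.dom j := fun j hj x y =>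
    ((hext j hj).2.1 x y).1
  have hpmap : ∀ j, i₀ ≤ j → ∀ x y, y ∈ Ω → X.p j (f y - x) = X.map j (x, X.p j y) :=
    fun j hj x y => ((hext j hj).2.1 x y).2
  have hbase : (x₀, X.p i₀ y₀) ∈ X.dom i₀ := hW₀dom hW₀
  have hfbase : X.map i₀ (x₀, X.p i₀ y₀) = 0 := by
    rw [← hpmap i₀ le_rfl x₀ y₀ hzΩ, hfz, map_zero]
  have hb₀ := ((hD i₀).partialTwoBijective_iff (hdomo i₀) hk hbase).1 hbij₀
  -- the implicit function at level `i₀`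
  have hO : {q | q ∈ W₀ ∧ Function.Bijective (partialTwo (D i₀) q)} ∈ 𝓝 (x₀, X.p i₀ y₀) := by
    obtain ⟨e, he⟩ := ContinuousLinearMap.isInvertible_of_bijective hb₀
    have h1 := (hD i₀).tendsto_partialTwo hk hbase
    rw [← he] at h1
    filter_upwards [hW₀o.mem_nhds hW₀, h1 e.nhds] with q hq hq'
    obtain ⟨e', he'⟩ := hq'
    exact ⟨hq, by rw [← he']; exact e'.bijective⟩
  obtain ⟨W₁, r, g₀, hW₁, hxW₁, hr, hg₀c, hg₀⟩ :=
    (hD i₀).exists_implicit (hdomo i₀) hk hbase hfbase hb₀ hO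
  obtain ⟨W, hWW₁, hW, hxW, hstar⟩ := exists_isOpen_star_subset 𝕜 (hW₁.mem_nhds hxW₁)
  have hg₀W : ContinuousOn g₀ W := hg₀c.mono hWW₁
  have hg₀self : ∀ x ∈ W, (x, g₀ x) ∈ W₀ ∧ Function.Bijective (partialTwo (D i₀) (x, g₀ x)) ∧
      (x, g₀ x) ∈ X.dom i₀ ∧ X.map i₀ (x, g₀ x) = 0 := fun x hx =>
    have h1 := (hg₀ x (hWW₁ hx)).2 _ (hg₀ x (hWW₁ hx)).1
    ⟨h1.1.1, h1.1.2, h1.2.1, h1.2.2.2 rfl⟩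
  have hg₀x₀ : g₀ x₀ = X.p i₀ y₀ :=
    (((hg₀ x₀ hxW₁).2 _ (Metric.mem_ball_self hr)).2.2.1 hfbase).symm
  -- the implicit functions at the higher levels
  have hbijj : ∀ j hj, ∀ x ∈ W, ∀ y, X.ρ i₀ j hj y = g₀ x →
      (x, y) ∈ X.dom j ∧ Function.Bijective (partialTwo (D j) (x, y)) := by
    intro j hj x hx y hy
    obtain ⟨h1, h2, h3, h4⟩ := hg₀self x hx
    have hxy : (x, y) ∈ X.dom j := (((hext j hj).2.2.1 x y).1).2 (by rw [hy]; exact h3)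
    refine ⟨hxy, (hext j hj).2.2.2.1 x y _ hxy
      ((hD j).hasPartialTwo (hdomo j) hk hxy) (by rw [hy]; exact h1) ?_⟩
    rw [hy]
    exact ((hD i₀).partialTwoBijective_iff (hdomo i₀) hk h3).2 h2
  have hlift : ∀ j (hj : i₀ ≤ j), ∃ g : E → X.B j, ContinuousOn g W ∧
      ∀ x ∈ W, X.ρ i₀ j hj (g x) = g₀ x := by
    intro j hj
    refine exists_continuousOn_lift (hinj j hj) (hD j) (hdomo j) hk
      (fun x y => ((hext j hj).2.2.1 x y).1) (fun x y => ((hext j hj).2.2.1 x y).2) hW hstar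
      (N := Metric.ball (X.p i₀ y₀) r) Metric.isOpen_ball
      (fun x hx => ⟨(hg₀ x (hWW₁ hx)).1, fun y hy => ((hg₀ x (hWW₁ hx)).2 y hy).2⟩)
      (fun x hx y hy => (hbijj j hj x hx y hy).2)
      (fun _ => ⟨X.p j y₀, by rw [hg₀x₀, hlim.1 i₀ j hj]⟩) fun x₁ hx₁ y hy => ?_
    refine (hext j hj).2.2.2.2 x₁ (g₀ x₁) y (fun n hn => ?_) (hg₀self x₁ hx₁).2.2.1 ?_ ?_
    · obtain ⟨h1, h2⟩ := hy n hn
      rw [h2, map_zero]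
      exact (hg₀self _ h1).2.2
    · rw [map_zero]
      exact (hg₀self x₁ hx₁).2.2.2
    -- The images of the lifts are values of `g₀` at points tending to `x₁`, so they converge to `g₀
    -- x₁` by continuity.
    · have hlimpt : Tendsto (fun n : ℕ => (n : 𝕜)⁻¹ • x₀ + (1 - (n : 𝕜)⁻¹) • x₁) atTop (𝓝 x₁) := by
        have h1 : Tendsto (fun n : ℕ => (n : 𝕜)⁻¹) atTop (𝓝 0) :=
          tendsto_inv_atTop_nhds_zero_nat (𝕜 := 𝕜)
        have h2 := (h1.smul_const x₀).add ((h1.const_sub 1).smul_const x₁)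
        simpa using h2
      refine (((hg₀W.continuousAt (hW.mem_nhds hx₁)).tendsto).comp hlimpt).congr' ?_
      filter_upwards [eventually_ge_atTop 1] with n hn
      exact (hy n hn).2.symm
  choose gj hgjc hgj using hlift
  have hex : ∀ x ∈ W, ∃ y : E, X.p i₀ y = g₀ x := fun x hx =>
    hlim.exists_of_forall_mem_range hproj hinj fun j hj => ⟨_, hgj j hj x hx⟩
  choose! g hg using hex
  have hpg : ∀ j hj, ∀ x ∈ W, X.p j (g x) = gj j hj x := fun j hj x hx => by
    apply hinj j hj
    rw [← hlim.1 i₀ j hj, hg x hx, hgj j hj x hx]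
  have hgΩ : ∀ x ∈ W, g x ∈ Ω := fun x hx => (hpdom i₀ le_rfl x (g x)).2 (by
    rw [hg x hx]; exact (hg₀self x hx).2.2.1)
  have hfg : ∀ x ∈ W, f (g x) = x := fun x hx => by
    refine sub_eq_zero.1 (hp ?_)
    rw [hpmap i₀ le_rfl x _ (hgΩ x hx), hg x hx, map_zero]
    exact (hg₀self x hx).2.2.2
  have hgK : ∃ G, HasLeftSeries 𝕜 k W g G := by
    refine hlim.exists_hasLeftSeries hproj hinj hW fun j hj => ?_
    obtain ⟨G, hG⟩ := (hD j).exists_hasLeftSeries_implicit (hdomo j) hk hW (hgjc j hj)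
      (fun x hx => (hbijj j hj x hx _ (hgj j hj x hx)).1)
      (fun x hx => (hinj j hj) (by
        rw [((hext j hj).2.2.1 x _).2 (hbijj j hj x hx _ (hgj j hj x hx)).1, hgj j hj x hx,
          map_zero]
        exact (hg₀self x hx).2.2.2))
      (fun x hx => (hbijj j hj x hx _ (hgj j hj x hx)).2)
    exact ⟨G, hG.congr fun x hx => hpg j hj x hx⟩
  have hΩ : IsOpen Ω := by
    have : Ω = (fun y => (x₀, X.p i₀ y)) ⁻¹' X.dom i₀ := Set.ext fun y => hpdom i₀ le_rfl x₀ y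
    rw [this]
    exact (hdomo i₀).preimage (by fun_prop)
  -- With the parameter frozen at `x₀`, the projection of `f y - x₀` to level `j` is `X.map j (x₀,
  -- X.p j y)`, a Keller map after an affine one; the constant `x₀` is added back at the end.
  have hfK : ∃ G, HasLeftSeries 𝕜 k Ω f G := by
    obtain ⟨G, hG⟩ := hlim.exists_hasLeftSeries hproj hinj hΩ (φ := fun y => f y - x₀) (k := k)
      fun j hj => by
        have h1 := (hD j).comp_affine (x₀, (0 : X.B j))
          ((ContinuousLinearMap.inr 𝕜 E (X.B j)).comp (X.p j))
        have e : ∀ y, (x₀, (0 : X.B j)) + ((ContinuousLinearMap.inr 𝕜 E (X.B j)).comp (X.p j)) y =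
            (x₀, X.p j y) := fun y => by simp
        simp only [e] at h1
        exact ⟨_, (h1.mono fun y hy => (hpdom j hj x₀ y).1 hy).congr fun y hy =>
          hpmap j hj x₀ y hy⟩
    obtain ⟨G', hG'⟩ := hG.add_const x₀
    exact ⟨G', hG'.congr fun y _ => (sub_add_cancel _ _).symm⟩
  obtain ⟨Df, hDf⟩ := hfK
  obtain ⟨Dg, hDg⟩ := hgK
  have hfc : ContinuousOn f Ω := fun y hy => (hDf.continuousAt hΩ hy).continuousWithinAt
  -- The ball condition is the region of uniqueness for the equation at level `i₀`; it forces `g (f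
  -- y) = y`.
  set U : Set E := (Ω ∩ f ⁻¹' W) ∩ X.p i₀ ⁻¹' Metric.ball (X.p i₀ y₀) r with hU
  have hUo : IsOpen U := (hfc.isOpen_inter_preimage hΩ hW).inter
    (Metric.isOpen_ball.preimage (X.p i₀).continuous)
  have hUΩ : U ⊆ Ω := fun y hy => hy.1.1
  have hgf : ∀ y ∈ U, g (f y) = y := by
    rintro y ⟨⟨hyΩ, hyW⟩, hyr⟩
    apply hp
    rw [hg _ hyW]
    refine (((hg₀ _ (hWW₁ hyW)).2 _ hyr).2.2.1 ?_).symm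
    rw [← hpmap i₀ le_rfl _ y hyΩ, sub_self, map_zero]
  have hgU : ∀ x ∈ W, g x ∈ U := fun x hx =>
    ⟨⟨hgΩ x hx, by rw [Set.mem_preimage, hfg x hx]; exact hx⟩, by
      rw [Set.mem_preimage, hg x hx]; exact (hg₀ x (hWW₁ hx)).1⟩
  have hinv : Set.InvOn g f U W := ⟨hgf, hfg⟩
  refine ⟨U, W, hUo, hW, hxW, ⟨⟨hzΩ, ?_⟩, Metric.mem_ball_self hr⟩, hUΩ,
    hinv.bijOn (fun y hy => hy.1.2) hgU, isKeller_iff_left.2 ⟨hUo, Df, hDf.mono hUΩ⟩,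
    g, hinv, isKeller_iff_left.2 ⟨hW, Dg, hDg⟩⟩
  rw [Set.mem_preimage, sub_eq_zero.1 hfz]
  exact hxW
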